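/- Let $q\ge 2$ be an integer, let $T$ be the $(q+1)$-regular tree (every vertex has exactly $q+1$ neighbours), with graph distance $d$, and let $A=-\Delta$ on $\ell^2(T)$ (counting measure), where $\Delta f(x)=\sum_{y\sim x}(f(y)-f(x))$. For $r\in\mathbb R$ let $E_r$ be the spectral projection of $A$ onto the part $(-\infty,r]$ of the spectrum, let $K_r(x,y)$ be its kernel, $E_rf(x)=\sum_y K_r(x,y)f(y)$, and put $\lambda_0=q+1-2\sqrt q$. Define $$c(z)=\frac1{q+1}\,\frac{q^{1-z}-q^{z-1}}{q^{-z}-q^{z-1}},\qquad \phi_z(n)=c(z)q^{-zn}+c(1-z)q^{-(1-z)n}\quad(n=0,1,2,\dots),$$ and let $m$ be the Plancherel measure on $0\le t\le \pi/\log q$, $$dm(t)=\frac{4q(q+1)\log q\,\sin^2(t\log q)}{2\pi\big((q-1)^2+4q\sin^2(t\log q)\big)}\,dt .$$ Then the density of $m$ equals $\frac{q\log q}{2\pi(q+1)}\,\big|c(\tfrac12+it)\big|^{-2}$ for $0<t<\pi/\log q$, each $t\mapsto\phi_{\frac12+it}(n)$ is $m$-integrable, $A$ is a bounded self-adjoint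 operator, and its spectrum is $[q+1-2\sqrt q,\;q+1+2\sqrt q]$. With $$I_r=\{t\in[0,\pi/\log q]:\ q+1-2\sqrt q\cos(t\log q)\le r\}$$ one has, for $r\ge\lambda_0$, $$I_r=\Big[0,\ \tfrac1{\log q}\arccos\tfrac{q+1-r}{2\sqrt q}\Big]$$ (where $\arccos u:=\pi$ for $u<-1$), and for all $r\in\mathbb R$ and all vertices $x,y$ $$K_r(x,y)=\int_{I_r}\phi_{\frac12+it}(d(x,y))\,dm(t).$$ In particular $K_r(x,x)$ does not depend on $x$, and this constant, the spectral mass $M(r)$, is $M(r)=m(I_r)=\int_{I_r}dm(t)$. Moreover $M(r)=0$ for all $r\le\lambda_0$, and $$M(\lambda_0+\varepsilon)=\frac{2q^{1/4}(q+1)}{3\pi(q-1)^2}\,\varepsilon^{3/2}+O(\varepsilon^{5/2})\qquad(\varepsilon\to0^+).$$ -/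

import Mathlib

open scoped lp

noncomputable section

namespace TreeSpectralMass

/-! ### The graph Laplacian on square-summable functions -/

/-- `-Δ f (x) = ∑_{y ∼ x} (f x - f y)`, on arbitrary functions. -/
def negLaplacianFun {V : Type*} (G : SimpleGraph V) [G.LocallyFinite] (f : V → ℂ) (x : V) : ℂ :=
  ∑ y ∈ G.neighborFinset x, (f x - f y)

theorem sum_norm_negLaplacianFun_le {V : Type*} {G : SimpleGraph V} [G.LocallyFinite] {d : ℕ}
    (h : G.IsRegularOfDegree d) (f : ℓ²(V, ℂ)) (s : Finset V) :
    ∑ x ∈ s, ‖negLaplacianFun G (f : V → ℂ) x‖ ^ (2 : ENNReal).toReal ≤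
      (2 * d * ‖f‖) ^ (2 : ENNReal).toReal := by
  classical
  have h2 : (0 : ℝ) < (2 : ENNReal).toReal := by norm_num
  have key : ∀ t : Finset V, ∑ x ∈ t, ‖f x‖ ^ 2 ≤ ‖f‖ ^ 2 := by
    intro t
    simpa using lp.sum_rpow_le_norm_rpow h2 f t
  have hpt : ∀ x, ‖negLaplacianFun G (f : V → ℂ) x‖ ^ 2 ≤
      2 * d * (d * ‖f x‖ ^ 2 + ∑ y ∈ G.neighborFinset x, ‖f y‖ ^ 2) := by
    intro x
    have hc : (G.neighborFinset x).card = d := h x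
    have h1 : ‖negLaplacianFun G (f : V → ℂ) x‖ ≤
        ∑ y ∈ G.neighborFinset x, ‖f x - f y‖ := norm_sum_le _ _
    have h3 : (∑ y ∈ G.neighborFinset x, ‖f x - f y‖) ^ 2 ≤
        d * ∑ y ∈ G.neighborFinset x, ‖f x - f y‖ ^ 2 := by
      have := sq_sum_le_card_mul_sum_sq (s := G.neighborFinset x) (f := fun y => ‖f x - f y‖)
      rwa [hc] at this
    have h4 : ∑ y ∈ G.neighborFinset x, ‖f x - f y‖ ^ 2 ≤
        ∑ y ∈ G.neighborFinset x, (2 * ‖f x‖ ^ 2 + 2 * ‖f y‖ ^ 2) := by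
      refine Finset.sum_le_sum fun y _ => ?_
      have h5 := norm_sub_le (f x) (f y)
      nlinarith [sq_nonneg (‖f x‖ - ‖f y‖), norm_nonneg (f x - f y)]
    have h6 : ∑ y ∈ G.neighborFinset x, (2 * ‖f x‖ ^ 2 + 2 * ‖f y‖ ^ 2) =
        2 * (d * ‖f x‖ ^ 2 + ∑ y ∈ G.neighborFinset x, ‖f y‖ ^ 2) := by
      rw [Finset.sum_add_distrib, Finset.sum_const, hc, ← Finset.mul_sum, nsmul_eq_mul]
      ring
    calc ‖negLaplacianFun G (f : V → ℂ) x‖ ^ 2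
        ≤ (∑ y ∈ G.neighborFinset x, ‖f x - f y‖) ^ 2 := by gcongr
      _ ≤ d * ∑ y ∈ G.neighborFinset x, ‖f x - f y‖ ^ 2 := h3
      _ ≤ d * (2 * (d * ‖f x‖ ^ 2 + ∑ y ∈ G.neighborFinset x, ‖f y‖ ^ 2)) := by
          rw [← h6]; gcongr
      _ = _ := by ring
  have hdouble : ∑ x ∈ s, ∑ y ∈ G.neighborFinset x, ‖f y‖ ^ 2 ≤ d * ‖f‖ ^ 2 := by
    have hswap : ∑ x ∈ s, ∑ y ∈ G.neighborFinset x, ‖f y‖ ^ 2 =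
        ∑ y ∈ s.biUnion fun x => G.neighborFinset x,
          ∑ x ∈ s with G.Adj x y, ‖f y‖ ^ 2 := by
      refine Finset.sum_comm' ?_
      intro x y
      simp only [SimpleGraph.mem_neighborFinset, Finset.mem_filter, Finset.mem_biUnion]
      exact ⟨fun ⟨hx, hy⟩ => ⟨⟨hx, hy⟩, x, hx, hy⟩, fun ⟨hx, _⟩ => hx⟩
    rw [hswap]
    calc _ ≤ ∑ y ∈ s.biUnion fun x => G.neighborFinset x, (d : ℝ) * ‖f y‖ ^ 2 := by
          refine Finset.sum_le_sum fun y _ => ?_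
          rw [Finset.sum_const, nsmul_eq_mul]
          have hcard : (s.filter fun x => G.Adj x y).card ≤ d := by
            rw [← h y]
            refine Finset.card_le_card fun x hx => ?_
            rw [SimpleGraph.mem_neighborFinset]
            exact (Finset.mem_filter.mp hx).2.symm
          gcongr
      _ = (d : ℝ) * ∑ y ∈ s.biUnion fun x => G.neighborFinset x, ‖f y‖ ^ 2 := by
          rw [Finset.mul_sum]
      _ ≤ _ := by gcongr; exact key _
  have hfin : ∑ x ∈ s, ‖negLaplacianFun G (f : V → ℂ) x‖ ^ 2 ≤ (2 * d * ‖f‖) ^ 2 := by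
    calc _ ≤ ∑ x ∈ s, 2 * d * (d * ‖f x‖ ^ 2 + ∑ y ∈ G.neighborFinset x, ‖f y‖ ^ 2) :=
          Finset.sum_le_sum fun x _ => hpt x
      _ = 2 * d * (d * ∑ x ∈ s, ‖f x‖ ^ 2 +
            ∑ x ∈ s, ∑ y ∈ G.neighborFinset x, ‖f y‖ ^ 2) := by
          rw [← Finset.mul_sum, Finset.sum_add_distrib, Finset.mul_sum s _ (d : ℝ)]
      _ ≤ 2 * d * (d * ‖f‖ ^ 2 + d * ‖f‖ ^ 2) := by
          gcongr
          exact key s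
      _ = _ := by ring
  simpa using hfin

/-- `A = -Δ` as a bounded operator on `ℓ²(V)` (counting measure), for a graph all of whose
vertices have degree `d`. -/
def negLaplacian {V : Type*} (G : SimpleGraph V) [G.LocallyFinite] {d : ℕ}
    (h : G.IsRegularOfDegree d) : ℓ²(V, ℂ) →L[ℂ] ℓ²(V, ℂ) :=
  LinearMap.mkContinuous
    { toFun := fun f =>
        ⟨fun x => negLaplacianFun G (f : V → ℂ) x, memℓp_gen' (sum_norm_negLaplacianFun_le h f)⟩
      map_add' := fun f g => by
        ext x
        simp only [negLaplacianFun, lp.coeFn_add, Pi.add_apply, ← Finset.sum_add_distrib]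
        exact Finset.sum_congr rfl fun y _ => by ring
      map_smul' := fun c f => by
        ext x
        simp only [negLaplacianFun, lp.coeFn_smul, Pi.smul_apply, smul_eq_mul, Finset.mul_sum,
          RingHom.id_apply]
        exact Finset.sum_congr rfl fun y _ => by ring }
    (2 * d)
    (fun f => lp.norm_le_of_forall_sum_le (by norm_num) (by positivity)
      (sum_norm_negLaplacianFun_le h f))

theorem negLaplacian_apply {V : Type*} (G : SimpleGraph V) [G.LocallyFinite] {d : ℕ}
    (h : G.IsRegularOfDegree d) (f : ℓ²(V, ℂ)) (x : V) :
    negLaplacian G h f x = ∑ y ∈ G.neighborFinset x, (f x - f y) := rfl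

/-! ### Spectral projections, their kernels, and the spectral mass -/

/-- The spectral resolution `E_r` of a bounded self-adjoint operator `A`: the orthogonal projection
onto the null space of the positive part `(A - r)⁺`, that is, the spectral projection of `A` for the
portion `(-∞, r]` of the spectrum (which is `[0, r]` when `A` is nonnegative). -/
def spectralProjection {H : Type*} [NormedAddCommGroup H] [InnerProductSpace ℂ H] [CompleteSpace H]
    (A : H →L[ℂ] H) (r : ℝ) : H →L[ℂ] H :=
  (LinearMap.ker (cfc (fun s : ℝ => max (s - r) 0) A).toLinearMap).starProjection

/-- `T` is the integral operator with kernel `K`, with respect to counting measure on `V`. -/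
def IsKernel {V : Type*} (T : ℓ²(V, ℂ) →L[ℂ] ℓ²(V, ℂ)) (K : V → V → ℂ) : Prop :=
  ∀ (f : ℓ²(V, ℂ)) (x : V), HasSum (fun y => K x y * f y) (T f x)

/-- `K r` is the kernel of the spectral projection `E_r` of `A`, and its diagonal value
`K r x x` does not depend on `x`; that constant (hence the average of `K r x x` over `V`) is the
spectral mass `M r`. -/
def IsSpectralMass {V : Type*} (A : ℓ²(V, ℂ) →L[ℂ] ℓ²(V, ℂ)) (K : ℝ → V → V → ℂ) (M : ℝ → ℝ) :
    Prop :=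
  (∀ r, IsKernel (spectralProjection A r) (K r)) ∧ ∀ r x, K r x x = (M r : ℂ)

/-! ### Harmonic analysis on the `(q+1)`-regular tree -/

/-- The `c`-function. -/
def cFun (q : ℕ) (z : ℂ) : ℂ :=
  1 / ((q : ℂ) + 1) * (((q : ℂ) ^ (1 - z) - (q : ℂ) ^ (z - 1)) / ((q : ℂ) ^ (-z) - (q : ℂ) ^ (z - 1)))

/-- The spherical function `φ_z` at distance `d` from the reference vertex. -/
def sphericalFun (q : ℕ) (z : ℂ) (d : ℕ) : ℂ :=
  cFun q z * (q : ℂ) ^ (-z * d) + cFun q (1 - z) * (q : ℂ) ^ (-(1 - z) * d)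

/-- The eigenvalue of `-Δ` attached to the spectral parameter `z = 1/2 + i t`. -/
def eigenvalue (q : ℕ) (t : ℝ) : ℝ :=
  q + 1 - 2 * √q * Real.cos (t * Real.log q)

/-- The density of the Plancherel measure in the spectral parameter `t`. -/
def plancherelDensity (q : ℕ) (t : ℝ) : ℝ :=
  4 * q * (q + 1) * Real.log q * Real.sin (t * Real.log q) ^ 2 /
    (2 * Real.pi * (((q : ℝ) - 1) ^ 2 + 4 * q * Real.sin (t * Real.log q) ^ 2))

/-- The Plancherel measure `m` on `[0, π / log q]`. -/
def plancherelMeasure (q : ℕ) : MeasureTheory.Measure ℝ :=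
  (MeasureTheory.volume.restrict (Set.Icc 0 (Real.pi / Real.log q))).withDensity
    fun t => ENNReal.ofReal (plancherelDensity q t)

/-- The set `I_r` of spectral parameters in `[0, π / log q]` with eigenvalue at most `r`. -/
def spectralInterval (q : ℕ) (r : ℝ) : Set ℝ :=
  {t ∈ Set.Icc 0 (Real.pi / Real.log q) | eigenvalue q t ≤ r}

/-- The bottom `q + 1 - 2√q` of the spectrum. -/
def specBottom (q : ℕ) : ℝ := q + 1 - 2 * √q

end TreeSpectralMass

end

namespace TreeSpectralMass

open MeasureTheory

/-! ### Neighbours in a regular tree -/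

/-! Write `θ = t log q`, and let `φ_n(t)` be `sphericalPoly`, which solves the radial eigenvalue
equation of `A` on the tree. A vertex `x ≠ y` has one neighbour nearer to `y` and `q` farther ones,
so `x ↦ φ_{d(x,y)}(t)` is an eigenfunction with eigenvalue `λ(t) = q + 1 - 2√q cos θ`
(`sum_neighbor_sphericalPoly`). These functions are not square-summable, but they resolve the
identity: `∫ φ_n dm` is `1` for `n = 0` and `0` otherwise (`integral_sphericalPoly`).

Together these two facts give, by induction on `n`, that the `(x,y)` entry of `A^n` is `∫ λ^n
φ_{d(x,y)} dm`. Weierstrass approximation extends this to `f(A)` for continuous `f`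
(`opFun_negLaplacian_single_apply`). Everything else is read off from this formula. The spectrum is
the range of `λ`, because the diagonal entry of `f²(A)` is `∫ f(λ)² dm` and the density is positive.
The kernel of `E_r` follows by approximating the indicator of `(-∞, r]` by continuous functions,
which converge strongly on the operator side (`tendsto_opFun_cutoff`) and dominatedly under the
integral.

For the asymptotics, the mass is the integral of a density of order `θ²` from `0` to the angle with
`ε = 4√q sin²(θ/2)`, hence of order `θ³`, that is `ε^(3/2)`. -/

/-- A neighbour nearer to `y` starts a geodesic, and paths in a tree are unique, so it is the second
vertex of that path. Adjacent vertices of a tree never have equal distance to `y`, so all other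
neighbours are farther. -/
theorem exists_adj_dist_add_one {V : Type*} {G : SimpleGraph V} (hG : G.IsTree) {x y : V}
    (hxy : x ≠ y) :
    ∃ p, G.Adj x p ∧ G.dist p y + 1 = G.dist x y ∧
      ∀ z, G.Adj x z → z ≠ p → G.dist z y = G.dist x y + 1 := by
  obtain ⟨w, hw, hlen⟩ := hG.connected.exists_path_of_dist x y
  have key : ∀ z, G.Adj x z → G.dist z y + 1 = G.dist x y → z = w.snd := by
    intro z hz hd
    obtain ⟨u, -, hu⟩ := hG.connected.exists_path_of_dist z y
    have hP : (SimpleGraph.Walk.cons hz u).IsPath :=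
      SimpleGraph.Walk.isPath_of_length_eq_dist _ (by simp [hu, hd])
    have := congrArg Subtype.val ((hG.isAcyclic.subsingleton_path x y).elim ⟨_, hP⟩ ⟨w, hw⟩)
    simp only at this
    rw [← this]; simp
  have hnn : ¬ w.Nil := SimpleGraph.Walk.not_nil_of_ne hxy
  refine ⟨w.snd, w.adj_snd hnn, ?_, ?_⟩
  · have h1 : G.dist w.snd y ≤ w.tail.length := SimpleGraph.dist_le _
    have h2 := SimpleGraph.Walk.length_tail_add_one hnn
    have h3 : G.dist x y ≤ G.dist x w.snd + G.dist w.snd y := hG.connected.dist_triangle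
    rw [SimpleGraph.dist_eq_one_iff_adj.2 (w.adj_snd hnn)] at h3
    omega
  · intro z hz hne
    rcases hG.dist_eq_dist_add_one_of_adj y hz with h | h
    · rw [G.dist_comm, G.dist_comm (u := y)] at h
      exact absurd (key z hz h.symm) hne
    · rw [G.dist_comm, h, G.dist_comm]

theorem sum_neighbor_dist_self {V : Type*} {G : SimpleGraph V} [G.LocallyFinite] {q : ℕ}
    (hreg : G.IsRegularOfDegree (q + 1)) (F : ℕ → ℝ) (y : V) :
    ∑ z ∈ G.neighborFinset y, F (G.dist z y) = (q + 1) * F 1 := by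
  have hc : (G.neighborFinset y).card = q + 1 := hreg y
  rw [Finset.sum_congr rfl (g := fun _ => F 1), Finset.sum_const, hc, nsmul_eq_mul]
  · push_cast; rfl
  · intro z hz
    rw [SimpleGraph.dist_eq_one_iff_adj.2 ((G.mem_neighborFinset y z).1 hz).symm]

/-- The natural subtraction does not truncate, since `x ≠ y` makes the distance positive. -/
theorem sum_neighbor_dist {V : Type*} {G : SimpleGraph V} [G.LocallyFinite] (hG : G.IsTree) {q : ℕ}
    (hreg : G.IsRegularOfDegree (q + 1)) (F : ℕ → ℝ) {x y : V} (hxy : x ≠ y) :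
    ∑ z ∈ G.neighborFinset x, F (G.dist z y) =
      F (G.dist x y - 1) + q * F (G.dist x y + 1) := by
  classical
  have hc : (G.neighborFinset x).card = q + 1 := hreg x
  obtain ⟨p, hp, hd, h⟩ := exists_adj_dist_add_one hG hxy
  have hp' := (G.mem_neighborFinset x p).2 hp
  rw [← Finset.add_sum_erase _ _ hp', ← hd, Nat.add_sub_cancel,
    Finset.sum_congr rfl (g := fun _ => F (G.dist p y + 1 + 1)), Finset.sum_const,
    Finset.card_erase_of_mem hp', hc, nsmul_eq_mul]
  · rfl
  · intro z hz
    rw [Finset.mem_erase, G.mem_neighborFinset] at hz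
    rw [h z hz.2 hz.1, hd]

/-! ### The spherical functions as trigonometric polynomials -/

/-- The spherical function of parameter `1/2 + it`, through its three-term recursion. -/
noncomputable def sphericalPoly (q : ℕ) (t : ℝ) : ℕ → ℝ
  | 0 => 1
  | 1 => 2 * √q * Real.cos (t * Real.log q) / (q + 1)
  | n + 2 => (2 * √q * Real.cos (t * Real.log q) * sphericalPoly q t (n + 1) -
      sphericalPoly q t n) / q

theorem continuous_eigenvalue (q : ℕ) : Continuous (eigenvalue q) := by
  unfold eigenvalue; fun_prop

theorem continuous_sphericalPoly (q n : ℕ) : Continuous fun t => sphericalPoly q t n := by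
  induction n using Nat.strong_induction_on with
  | _ n ih =>
    match n with
    | 0 => simp only [sphericalPoly]; fun_prop
    | 1 => simp only [sphericalPoly]; fun_prop
    | n + 2 =>
      have h0 := ih n (by omega)
      have h1 := ih (n + 1) (by omega)
      simp only [sphericalPoly]; fun_prop

/-- At `x = y` all neighbours are at distance one, and the identity is the value prescribed for
`φ_1`; elsewhere it is the three-term recursion. -/
theorem sum_neighbor_sphericalPoly {V : Type*} {G : SimpleGraph V} [G.LocallyFinite]
    (hG : G.IsTree) {q : ℕ} (hq : 1 < q) (hreg : G.IsRegularOfDegree (q + 1)) (t : ℝ) (x y : V) :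
    ∑ z ∈ G.neighborFinset x, (sphericalPoly q t (G.dist x y) - sphericalPoly q t (G.dist z y)) =
      eigenvalue q t * sphericalPoly q t (G.dist x y) := by
  have hq0 : (q : ℝ) ≠ 0 := by positivity
  have hq1 : (q : ℝ) + 1 ≠ 0 := by positivity
  have hc : (G.neighborFinset x).card = q + 1 := hreg x
  rw [Finset.sum_sub_distrib, Finset.sum_const, hc, nsmul_eq_mul]
  push_cast
  by_cases hxy : x = y
  · subst hxy
    rw [sum_neighbor_dist_self hreg]
    simp only [SimpleGraph.dist_self, sphericalPoly, eigenvalue]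
    field_simp
  · rw [sum_neighbor_dist hG hreg _ hxy]
    obtain ⟨n, hn⟩ := Nat.exists_eq_succ_of_ne_zero (hG.connected.pos_dist_of_ne hxy).ne'
    rw [hn]
    simp only [Nat.succ_eq_add_one, Nat.add_sub_cancel, sphericalPoly, eigenvalue]
    field_simp
    ring

/-- Rescaling by `√q ^ n` turns the recursion into the Chebyshev one, which sines of multiples of
`θ` satisfy. The subtraction `n - 1` is real, so `n = 0` yields `sin (-θ)`. -/
theorem sin_mul_sphericalPoly {q : ℕ} (hq : 1 < q) (t : ℝ) (n : ℕ) :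
    Real.sin (t * Real.log q) * (√q ^ n * (q + 1) * sphericalPoly q t n) =
      q * Real.sin ((n + 1) * (t * Real.log q)) - Real.sin ((n - 1) * (t * Real.log q)) := by
  have hq0 : (q : ℝ) ≠ 0 := by positivity
  have hq1 : (q : ℝ) + 1 ≠ 0 := by positivity
  have hs : √(q : ℝ) ^ 2 = q := Real.sq_sqrt (by positivity)
  generalize hθ : t * Real.log q = θ
  induction n using Nat.strong_induction_on with
  | _ n ih =>
    match n with
    | 0 =>
      simp [sphericalPoly]
      ring
    | 1 =>
      simp only [sphericalPoly, hθ]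
      push_cast
      rw [show ((1 : ℝ) + 1) * θ = 2 * θ by ring, Real.sin_two_mul]
      field_simp
      rw [hs]; simp
    | n + 2 =>
      have h0 := ih n (by omega)
      have h1 := ih (n + 1) (by omega)
      simp only [sphericalPoly, hθ]
      push_cast at h0 h1 ⊢
      have e1 : Real.sin θ * (√q ^ (n + 2) * (q + 1) * ((2 * √q * Real.cos θ *
          sphericalPoly q t (n + 1) - sphericalPoly q t n) / q)) =
          2 * Real.cos θ * (Real.sin θ * (√q ^ (n + 1) * (q + 1) * sphericalPoly q t (n + 1))) -
          (Real.sin θ * (√q ^ n * (q + 1) * sphericalPoly q t n)) := by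
        field_simp
        rw [pow_add, hs]
        ring
      rw [e1, h0, h1]
      have e2 : ∀ a : ℝ, 2 * Real.cos θ * Real.sin (a * θ) =
          Real.sin ((a + 1) * θ) + Real.sin ((a - 1) * θ) := by
        intro a
        rw [add_mul, sub_mul, one_mul, Real.sin_add, Real.sin_sub]; ring
      have e3 := e2 (n + 1 + 1)
      have e4 := e2 (n + 1 - 1)
      rw [show (n : ℝ) + 2 + 1 = n + 1 + 1 + 1 by ring, show (n : ℝ) + 2 - 1 = n + 1 - 1 + 1 by ring]
      rw [show (n : ℝ) + 1 + 1 - 1 = n + 1 by ring] at e3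
      rw [show (n : ℝ) + 1 - 1 - 1 = n - 1 by ring] at e4
      linear_combination (q : ℝ) * e3 - e4

theorem log_pos_of_one_lt {q : ℕ} (hq : 1 < q) : 0 < Real.log q :=
  Real.log_pos (by exact_mod_cast hq)

theorem mul_log_mem_Ioo {q : ℕ} (hq : 1 < q) {t : ℝ} (ht : t ∈ Set.Ioo 0 (Real.pi / Real.log q)) :
    t * Real.log q ∈ Set.Ioo 0 Real.pi :=
  ⟨mul_pos ht.1 (log_pos_of_one_lt hq), (lt_div_iff₀ (log_pos_of_one_lt hq)).1 ht.2⟩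

/-- The power `q ^ (-1/2 + is)` in polar form. -/
theorem natCast_cpow_half {q : ℕ} (hq : 1 < q) (s : ℝ) (k : ℂ) (hk : k = -(1 / 2) + Complex.I * s) :
    (q : ℂ) ^ k = ((√q)⁻¹ : ℝ) * Complex.exp (Complex.I * (s * Real.log q : ℝ)) := by
  have hq0 : (q : ℂ) ≠ 0 := by exact_mod_cast (by omega : q ≠ 0)
  have hp : (0 : ℝ) < q := by positivity
  rw [hk, Complex.cpow_add _ _ hq0]
  congr 1
  · rw [← Real.sqrt_inv, Real.sqrt_eq_rpow, Complex.ofReal_cpow (by positivity)]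
    push_cast
    rw [Complex.inv_cpow, Complex.cpow_neg]
    simp [Complex.natCast_arg, Real.pi_ne_zero.symm]
  · rw [Complex.cpow_def_of_ne_zero hq0, ← Complex.ofReal_natCast, ← Complex.ofReal_log hp.le]
    push_cast
    ring_nf

/-- In this form the substitution `z ↦ 1 - z` merely exchanges the two powers of `q`. -/
theorem cFun_eq_of_roots {q : ℕ} (hq : 1 < q) (z : ℂ) :
    cFun q z = (q * (q : ℂ) ^ (-z) - (q : ℂ) ^ (-(1 - z))) /
      ((q + 1) * ((q : ℂ) ^ (-z) - (q : ℂ) ^ (-(1 - z)))) := by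
  have hq0 : (q : ℂ) ≠ 0 := by exact_mod_cast (by omega : q ≠ 0)
  rw [cFun, show (1 : ℂ) - z = 1 + -z by ring, show z - 1 = -(1 + -z) by ring,
    Complex.cpow_add 1 (-z) hq0, Complex.cpow_one, div_mul_div_comm, one_mul]

theorem cpow_neg_sub_cpow_neg {q : ℕ} (hq : 1 < q) (t : ℝ) :
    (q : ℂ) ^ (-(1 / 2 + Complex.I * t)) =
      ((√q)⁻¹ : ℝ) * (Real.cos (t * Real.log q) - Real.sin (t * Real.log q) * Complex.I) ∧
    (q : ℂ) ^ (-(1 - (1 / 2 + Complex.I * t))) =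
      ((√q)⁻¹ : ℝ) * (Real.cos (t * Real.log q) + Real.sin (t * Real.log q) * Complex.I) := by
  constructor
  · rw [natCast_cpow_half hq (-t) _ (by push_cast; ring), mul_comm Complex.I, Complex.exp_mul_I,
      ← Complex.ofReal_cos, ← Complex.ofReal_sin, neg_mul, Real.cos_neg, Real.sin_neg]
    push_cast; ring
  · rw [natCast_cpow_half hq t _ (by ring), mul_comm Complex.I, Complex.exp_mul_I,
      ← Complex.ofReal_cos, ← Complex.ofReal_sin]

/-- The powers `a` and `b` are the roots of `q X² - 2√q cos θ X + 1` (`hsum`, `hprod`), so any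
combination of `a ^ n` and `b ^ n` obeys the recursion, and the `c`-function supplies the
coefficients matching `n = 0, 1`. The roots are distinct exactly when `sin θ ≠ 0`. -/
theorem sphericalFun_eq_sphericalPoly {q : ℕ} (hq : 1 < q) {t : ℝ}
    (hs : Real.sin (t * Real.log q) ≠ 0) (n : ℕ) :
    sphericalFun q (1 / 2 + Complex.I * t) n = sphericalPoly q t n := by
  have hq0 : (q : ℂ) ≠ 0 := by exact_mod_cast (by omega : q ≠ 0)
  have hq1 : (q : ℂ) + 1 ≠ 0 := by exact_mod_cast (by omega : q + 1 ≠ 0)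
  obtain ⟨h1, h2⟩ := cpow_neg_sub_cpow_neg hq t
  unfold sphericalFun
  rw [cFun_eq_of_roots hq, cFun_eq_of_roots hq, sub_sub_cancel, Complex.cpow_mul_nat,
    Complex.cpow_mul_nat]
  set a := (q : ℂ) ^ (-(1 / 2 + Complex.I * t)) with ha
  set b := (q : ℂ) ^ (-(1 - (1 / 2 + Complex.I * t))) with hb
  have hsq : (√q : ℂ) ^ 2 = q := by
    rw [← Complex.ofReal_pow, Real.sq_sqrt (by positivity)]; simp
  have hsq0 : (√q : ℂ) ≠ 0 := by
    intro h; rw [h] at hsq; exact hq0 (by simpa using hsq.symm)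
  have hsum : q * (a + b) = 2 * √q * Real.cos (t * Real.log q) := by
    rw [h1, h2]; push_cast; rw [← hsq]; field_simp; ring
  have hprod : q * (a * b) = 1 := by
    have := Complex.cos_sq_add_sin_sq ((t * Real.log q : ℝ) : ℂ)
    rw [← Complex.ofReal_cos, ← Complex.ofReal_sin] at this
    rw [h1, h2]; push_cast at this ⊢
    generalize Complex.cos (t * Complex.log q) = u at *
    generalize Complex.sin (t * Complex.log q) = v at *
    rw [← hsq]; field_simp
    linear_combination this - v ^ 2 * Complex.I_sq
  have hne : a - b ≠ 0 := by
    rw [h1, h2, show ((√q)⁻¹ : ℝ) * ((Real.cos (t * Real.log q) : ℂ) -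
      Real.sin (t * Real.log q) * Complex.I) - ((√q)⁻¹ : ℝ) * ((Real.cos (t * Real.log q) : ℂ) +
      Real.sin (t * Real.log q) * Complex.I) =
      -(2 * ((√q)⁻¹ : ℝ) * Real.sin (t * Real.log q) * Complex.I) by ring]
    have : (Real.sin (t * Real.log q) : ℂ) ≠ 0 := by exact_mod_cast hs
    simp only [ne_eq, neg_eq_zero, mul_eq_zero, Complex.I_ne_zero, this, or_false]
    simpa using hsq0
  have hne' : b - a ≠ 0 := by rw [← neg_sub]; exact neg_ne_zero.2 hne
  have hba : b - a = -(a - b) := by ring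
  clear_value a b
  induction n using Nat.strong_induction_on with
  | _ n ih =>
    match n with
    | 0 =>
      simp only [sphericalPoly, pow_zero]
      rw [hba]; field_simp; push_cast; ring
    | 1 =>
      simp only [sphericalPoly, pow_one]
      push_cast at hsum ⊢
      rw [← hsum, hba]; field_simp; ring
    | n + 2 =>
      have h0 := ih n (by omega)
      have h1 := ih (n + 1) (by omega)
      simp only [sphericalPoly]
      push_cast at hsum ⊢
      rw [← hsum, ← h0, ← h1, eq_div_iff hq0]
      generalize (q * a - b) / ((q + 1) * (a - b)) = A
      generalize (q * b - a) / ((q + 1) * (b - a)) = B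
      linear_combination -(A * a ^ n + B * b ^ n) * hprod

/-- The two roots are conjugate here; the denominator of the density arises from `(q-1)² cos² θ +
(q+1)² sin² θ = (q-1)² + 4q sin² θ`. -/
theorem plancherelDensity_eq_cFun {q : ℕ} (hq : 1 < q) {t : ℝ}
    (hs : Real.sin (t * Real.log q) ≠ 0) :
    plancherelDensity q t = q * Real.log q / (2 * Real.pi * (q + 1)) *
      (‖cFun q (1 / 2 + Complex.I * t)‖ ^ 2)⁻¹ := by
  obtain ⟨h1, h2⟩ := cpow_neg_sub_cpow_neg hq t
  have hp : (1 : ℝ) < q := by exact_mod_cast hq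
  have hq0 : (q : ℝ) ≠ 0 := by positivity
  have hsq : √(q : ℝ) ^ 2 = q := Real.sq_sqrt (by positivity)
  have hsq0 : √(q : ℝ) ≠ 0 := by positivity
  rw [cFun_eq_of_roots hq, h1, h2, norm_div, norm_mul]
  have e1 : (q * (((√q)⁻¹ : ℝ) * ((Real.cos (t * Real.log q) : ℂ) -
      Real.sin (t * Real.log q) * Complex.I)) - ((√q)⁻¹ : ℝ) * ((Real.cos (t * Real.log q) : ℂ) +
      Real.sin (t * Real.log q) * Complex.I) : ℂ) =
      ((√q)⁻¹ * (q - 1) * Real.cos (t * Real.log q) : ℝ) +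
      (-((√q)⁻¹ * (q + 1) * Real.sin (t * Real.log q)) : ℝ) * Complex.I := by
    push_cast; ring
  have e2 : (((√q)⁻¹ : ℝ) * ((Real.cos (t * Real.log q) : ℂ) -
      Real.sin (t * Real.log q) * Complex.I) - ((√q)⁻¹ : ℝ) * ((Real.cos (t * Real.log q) : ℂ) +
      Real.sin (t * Real.log q) * Complex.I) : ℂ) =
      (0 : ℝ) + (-(2 * (√q)⁻¹ * Real.sin (t * Real.log q)) : ℝ) * Complex.I := by
    push_cast; ring
  have e3 : ‖(q : ℂ) + 1‖ = q + 1 := by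
    rw [show (q : ℂ) + 1 = ((q + 1 : ℝ) : ℂ) by push_cast; rfl, Complex.norm_real,
      Real.norm_of_nonneg (by positivity)]
  rw [e1, e2, e3, div_pow, mul_pow, Complex.sq_norm, Complex.sq_norm, Complex.normSq_add_mul_I,
    Complex.normSq_add_mul_I]
  have e4 : ((√q)⁻¹ * (q - 1) * Real.cos (t * Real.log q)) ^ 2 +
      (-((√q)⁻¹ * (q + 1) * Real.sin (t * Real.log q))) ^ 2 =
      (((q : ℝ) - 1) ^ 2 + 4 * q * Real.sin (t * Real.log q) ^ 2) / q := by
    rw [neg_sq, mul_pow, mul_pow, mul_pow, mul_pow, Real.cos_sq', inv_pow, hsq]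
    field_simp; ring
  have e5 : (0 : ℝ) ^ 2 + (-(2 * (√q)⁻¹ * Real.sin (t * Real.log q))) ^ 2 =
      4 * Real.sin (t * Real.log q) ^ 2 / q := by
    rw [neg_sq, mul_pow, mul_pow, inv_pow, hsq]
    field_simp; ring
  have hD : 0 < ((q : ℝ) - 1) ^ 2 + 4 * q * Real.sin (t * Real.log q) ^ 2 := by
    have : 0 < (q : ℝ) - 1 := by linarith
    positivity
  rw [e4, e5, plancherelDensity, inv_div]
  have hpi := Real.pi_ne_zero
  field_simp

/-! ### Orthogonality -/

theorem integral_cos_nat_mul {m : ℕ} (hm : m ≠ 0) :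
    ∫ θ in (0 : ℝ)..Real.pi, Real.cos (m * θ) = 0 := by
  rw [intervalIntegral.integral_comp_mul_left _ (by exact_mod_cast hm), integral_cos]
  simp [Real.sin_nat_mul_pi]

theorem integral_sin_mul_sin_nat (n : ℕ) :
    ∫ θ in (0 : ℝ)..Real.pi, Real.sin θ * Real.sin ((n + 1) * θ) =
      if n = 0 then Real.pi / 2 else 0 := by
  have h : ∀ θ : ℝ, Real.sin θ * Real.sin ((n + 1) * θ) =
      (Real.cos (n * θ) - Real.cos ((n + 2 : ℕ) * θ)) / 2 := by
    intro θ
    push_cast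
    rw [show (n : ℝ) * θ = (n + 1) * θ - θ by ring,
      show ((n : ℝ) + 2) * θ = (n + 1) * θ + θ by ring, Real.cos_sub, Real.cos_add]
    ring
  simp_rw [h]
  rw [intervalIntegral.integral_div, intervalIntegral.integral_sub
    (Continuous.intervalIntegrable (by fun_prop) _ _)
    (Continuous.intervalIntegrable (by fun_prop) _ _), integral_cos_nat_mul (Nat.succ_ne_zero (n + 1))]
  split_ifs with hn
  · simp [hn]
  · rw [integral_cos_nat_mul hn]; simp

theorem denominator_pos {q : ℕ} (hq : 1 < q) (θ : ℝ) :
    0 < ((q : ℝ) - 1) ^ 2 + 4 * q * Real.sin θ ^ 2 := by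
  have : 0 < (q : ℝ) - 1 := sub_pos.2 (by exact_mod_cast hq)
  positivity

/-- The `n`-th spherical function times the Plancherel density, up to a factor. -/
noncomputable def sphericalIntegrand (q n : ℕ) (θ : ℝ) : ℝ :=
  Real.sin θ * (q * Real.sin ((n + 1) * θ) - Real.sin ((n - 1) * θ)) /
    (((q : ℝ) - 1) ^ 2 + 4 * q * Real.sin θ ^ 2)

/-- The integral of the `n`-th spherical function against the Plancherel density, up to a factor. -/
noncomputable def sphericalIntegral (q n : ℕ) : ℝ :=
  ∫ θ in (0 : ℝ)..Real.pi, sphericalIntegrand q n θ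

/-- Since `sin ((n+3)θ) + sin ((n-1)θ) = 2 sin ((n+1)θ) cos 2θ`, the combined numerator acquires the
factor `q² + 1 - 2q cos 2θ`, which is the denominator. Only a product of two sines remains. -/
theorem sphericalIntegral_recursion {q : ℕ} (hq : 1 < q) (n : ℕ) :
    q * sphericalIntegral q n - sphericalIntegral q (n + 2) =
      if n = 0 then Real.pi / 2 else 0 := by
  have hc : ∀ k : ℕ, Continuous (sphericalIntegrand q k) := fun k =>
    Continuous.div (by fun_prop) (by fun_prop) fun θ => (denominator_pos hq θ).ne'
  rw [← integral_sin_mul_sin_nat, sphericalIntegral, sphericalIntegral,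
    ← intervalIntegral.integral_const_mul, ← intervalIntegral.integral_sub
      (((hc n).const_mul _).intervalIntegrable _ _) ((hc (n + 2)).intervalIntegrable _ _)]
  refine intervalIntegral.integral_congr fun θ _ => ?_
  have hD := (denominator_pos hq θ).ne'
  simp only [sphericalIntegrand]
  rw [← mul_div_assoc, ← sub_div, div_eq_iff hD]
  push_cast
  rw [show ((n : ℝ) + 2 + 1) * θ = (n + 1) * θ + 2 * θ by ring,
    show ((n : ℝ) + 2 - 1) * θ = (n + 1) * θ by ring,
    show ((n : ℝ) - 1) * θ = (n + 1) * θ - 2 * θ by ring, Real.sin_add, Real.sin_sub,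
    Real.cos_two_mul, Real.cos_sq']
  ring

theorem sphericalIntegral_bounded {q : ℕ} (hq : 1 < q) :
    ∃ C, ∀ n, |sphericalIntegral q n| ≤ C := by
  have hq' : 0 < (q : ℝ) - 1 := sub_pos.2 (by exact_mod_cast hq)
  refine ⟨(q + 1) / ((q : ℝ) - 1) ^ 2 * |Real.pi - 0|, fun n => ?_⟩
  rw [← Real.norm_eq_abs (sphericalIntegral q n), sphericalIntegral]
  refine intervalIntegral.norm_integral_le_of_norm_le_const fun θ _ => ?_
  rw [sphericalIntegrand, norm_div, Real.norm_of_nonneg (denominator_pos hq θ).le, norm_mul]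
  have h1 : ‖Real.sin θ‖ ≤ 1 := Real.abs_sin_le_one θ
  have h2 : ‖q * Real.sin ((n + 1) * θ) - Real.sin ((n - 1) * θ)‖ ≤ q + 1 := by
    refine (norm_sub_le _ _).trans (add_le_add ?_ (Real.abs_sin_le_one _))
    rw [norm_mul, Real.norm_natCast]
    exact mul_le_of_le_one_right (by positivity) (Real.abs_sin_le_one _)
  refine div_le_div₀ (by positivity) ?_ (by positivity) (le_add_of_nonneg_right (by positivity))
  calc _ ≤ 1 * ((q : ℝ) + 1) := mul_le_mul h1 h2 (norm_nonneg _) zero_le_one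
    _ = _ := one_mul _

/-- For `n ≥ 1` the recursion is homogeneous and multiplies by `q > 1` at every second index, which
boundedness allows only for the value `0`. The case `n = 0` then follows from the vanishing at `2`.
-/
theorem sphericalIntegral_eq {q : ℕ} (hq : 1 < q) (n : ℕ) :
    sphericalIntegral q n = if n = 0 then Real.pi / (2 * q) else 0 := by
  have hpos : ∀ n, n ≠ 0 → sphericalIntegral q n = 0 := by
    intro n hn
    obtain ⟨C, hC⟩ := sphericalIntegral_bounded hq
    have hk : ∀ k : ℕ, sphericalIntegral q (n + 2 * k) = q ^ k * sphericalIntegral q n := by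
      intro k
      induction k with
      | zero => simp
      | succ k ih =>
        have := sphericalIntegral_recursion hq (n + 2 * k)
        rw [if_neg (by omega), ih] at this
        rw [show n + 2 * (k + 1) = n + 2 * k + 2 by ring, pow_succ]
        linarith
    by_contra h0
    have h0' := abs_pos.2 h0
    obtain ⟨k, hk'⟩ := pow_unbounded_of_one_lt (C / |sphericalIntegral q n|)
      (show (1 : ℝ) < q by exact_mod_cast hq)
    have h1 := hC (n + 2 * k)
    rw [hk, abs_mul, abs_of_nonneg (by positivity)] at h1
    rw [div_lt_iff₀ h0'] at hk'
    linarith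
  split_ifs with hn
  · subst hn
    have := sphericalIntegral_recursion hq 0
    rw [hpos 2 (by norm_num), if_pos rfl] at this
    field_simp
    linarith
  · exact hpos n hn

/-! ### The Plancherel measure -/

theorem continuous_plancherelDensity {q : ℕ} (hq : 1 < q) : Continuous (plancherelDensity q) := by
  unfold plancherelDensity
  refine Continuous.div (by fun_prop) (by fun_prop) fun t => ?_
  exact mul_ne_zero (by positivity) (denominator_pos hq _).ne'

theorem plancherelDensity_nonneg {q : ℕ} (hq : 1 < q) (t : ℝ) : 0 ≤ plancherelDensity q t := by
  have := denominator_pos hq (t * Real.log q)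
  have := log_pos_of_one_lt hq
  unfold plancherelDensity
  positivity

theorem plancherelDensity_pos {q : ℕ} (hq : 1 < q) {t : ℝ}
    (ht : t ∈ Set.Ioo 0 (Real.pi / Real.log q)) : 0 < plancherelDensity q t := by
  have := denominator_pos hq (t * Real.log q)
  have := log_pos_of_one_lt hq
  have h := mul_log_mem_Ioo hq ht
  have := Real.sin_pos_of_pos_of_lt_pi h.1 h.2
  unfold plancherelDensity
  positivity

theorem integrable_plancherelMeasure_of_continuous {q : ℕ} (hq : 1 < q) {E : Type*}
    [NormedAddCommGroup E] [NormedSpace ℝ E] {g : ℝ → E} (hg : Continuous g) :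
    Integrable g (plancherelMeasure q) := by
  rw [plancherelMeasure, integrable_withDensity_iff_integrable_smul'
    (continuous_plancherelDensity hq).measurable.ennreal_ofReal
    (Filter.Eventually.of_forall fun _ => ENNReal.ofReal_lt_top)]
  simp_rw [ENNReal.toReal_ofReal (plancherelDensity_nonneg hq _)]
  exact ((continuous_plancherelDensity hq).smul hg).integrableOn_Icc

theorem setIntegral_plancherelMeasure {q : ℕ} (hq : 1 < q) {E : Type*} [NormedAddCommGroup E]
    [NormedSpace ℝ E] (g : ℝ → E) {S : Set ℝ} (hS : MeasurableSet S)
    (hsub : S ⊆ Set.Icc 0 (Real.pi / Real.log q)) :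
    ∫ t in S, g t ∂(plancherelMeasure q) = ∫ t in S, plancherelDensity q t • g t := by
  rw [plancherelMeasure, setIntegral_withDensity_eq_setIntegral_toReal_smul
    (continuous_plancherelDensity hq).measurable.ennreal_ofReal
    (Filter.Eventually.of_forall fun _ => ENNReal.ofReal_lt_top) _ hS,
    Measure.restrict_restrict hS, Set.inter_eq_left.2 hsub]
  simp_rw [ENNReal.toReal_ofReal (plancherelDensity_nonneg hq _)]

theorem integral_plancherelMeasure {q : ℕ} (hq : 1 < q) {E : Type*} [NormedAddCommGroup E]
    [NormedSpace ℝ E] (g : ℝ → E) :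
    ∫ t, g t ∂(plancherelMeasure q) =
      ∫ t in (0 : ℝ)..(Real.pi / Real.log q), plancherelDensity q t • g t := by
  have := log_pos_of_one_lt hq
  rw [plancherelMeasure, integral_withDensity_eq_integral_toReal_smul
    (continuous_plancherelDensity hq).measurable.ennreal_ofReal
    (Filter.Eventually.of_forall fun _ => ENNReal.ofReal_lt_top),
    intervalIntegral.integral_of_le (by positivity), ← integral_Icc_eq_integral_Ioc]
  simp_rw [ENNReal.toReal_ofReal (plancherelDensity_nonneg hq _)]

theorem plancherelMeasure_apply {q : ℕ} (hq : 1 < q) {S : Set ℝ} (hS : MeasurableSet S)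
    (hsub : S ⊆ Set.Icc 0 (Real.pi / Real.log q)) :
    plancherelMeasure q S = ENNReal.ofReal (∫ t in S, plancherelDensity q t) := by
  rw [plancherelMeasure, withDensity_apply _ hS, Measure.restrict_restrict hS,
    Set.inter_eq_left.2 hsub, ofReal_integral_eq_lintegral_ofReal]
  · exact (continuous_plancherelDensity hq).integrableOn_Icc.mono_set hsub
  · exact Filter.Eventually.of_forall (plancherelDensity_nonneg hq)

/-- This discards the endpoints, where `sin θ = 0` and the `c`-function formula degenerates. -/
theorem ae_mem_Ioo_plancherelMeasure (q : ℕ) :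
    ∀ᵐ t ∂(plancherelMeasure q), t ∈ Set.Ioo 0 (Real.pi / Real.log q) := by
  refine (withDensity_absolutelyContinuous _ _).ae_le ?_
  rw [← restrict_Ioo_eq_restrict_Icc]
  exact ae_restrict_mem measurableSet_Ioo

theorem ae_sphericalFun_eq {q : ℕ} (hq : 1 < q) (n : ℕ) :
    (fun t : ℝ => sphericalFun q (1 / 2 + Complex.I * t) n) =ᵐ[plancherelMeasure q]
      fun t => (sphericalPoly q t n : ℂ) := by
  filter_upwards [ae_mem_Ioo_plancherelMeasure q] with t ht
  have h := mul_log_mem_Ioo hq ht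
  exact sphericalFun_eq_sphericalPoly hq (Real.sin_pos_of_pos_of_lt_pi h.1 h.2).ne' n

theorem integral_sphericalPoly {q : ℕ} (hq : 1 < q) (n : ℕ) :
    ∫ t, sphericalPoly q t n ∂(plancherelMeasure q) = if n = 0 then 1 else 0 := by
  have hL := log_pos_of_one_lt hq
  have hq0 : (q : ℝ) ≠ 0 := by positivity
  have hs : √(q : ℝ) ^ n ≠ 0 := by positivity
  have hpt : ∀ t, plancherelDensity q t • sphericalPoly q t n =
      4 * q * Real.log q / (2 * Real.pi * √q ^ n) *
      sphericalIntegrand q n (t * Real.log q) := by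
    intro t
    have hD := (denominator_pos hq (t * Real.log q)).ne'
    have hpi := Real.pi_ne_zero
    -- One factor of the `sin²` in the density is spent on `sin_mul_sphericalPoly`, so no division
    -- by `sin θ` occurs and the identity holds for every `t`.
    rw [smul_eq_mul, sphericalIntegrand, ← sin_mul_sphericalPoly hq, plancherelDensity]
    field_simp
  rw [integral_plancherelMeasure hq]
  simp_rw [hpt]
  rw [intervalIntegral.integral_const_mul, intervalIntegral.integral_comp_mul_right _ hL.ne',
    zero_mul, div_mul_cancel₀ _ hL.ne', smul_eq_mul]
  change _ * (_ * sphericalIntegral q n) = _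
  rw [sphericalIntegral_eq hq]
  split_ifs with hn
  · subst hn
    have hpi := Real.pi_ne_zero
    rw [pow_zero]
    field_simp
    norm_num
  · simp

/-! ### Continuous functional calculus of a bounded self-adjoint operator -/

section FunctionalCalculus

variable {H : Type*} [NormedAddCommGroup H] [InnerProductSpace ℂ H] [CompleteSpace H]

/-- `f(A)` for a self-adjoint operator `A` and a real function `f`. -/
noncomputable def opFun (A : H →L[ℂ] H) (f : ℝ → ℝ) : H →L[ℂ] H := cfc f A

variable {A : H →L[ℂ] H}

theorem opFun_congr {f g : ℝ → ℝ} (h : ∀ s ∈ spectrum ℝ A, f s = g s) :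
    opFun A f = opFun A g := cfc_congr h

theorem norm_opFun_le {f : ℝ → ℝ} {c : ℝ} (hc : 0 ≤ c) (h : ∀ s, |f s| ≤ c) :
    ‖opFun A f‖ ≤ c := norm_cfc_le hc fun s _ => h s

theorem opFun_mul {f g : ℝ → ℝ} (hf : Continuous f) (hg : Continuous g) :
    opFun A (fun s => f s * g s) = opFun A f * opFun A g :=
  cfc_mul f g A hf.continuousOn hg.continuousOn

theorem norm_opFun_sub_aeval_le (hA : IsSelfAdjoint A) {f : ℝ → ℝ} (hf : Continuous f)
    (p : Polynomial ℝ) {c : ℝ} (hc : 0 ≤ c) (h : ∀ s, |s| ≤ ‖A‖ → |p.eval s - f s| ≤ c) :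
    ‖opFun A f - Polynomial.aeval A p‖ ≤ c := by
  rw [opFun, ← cfc_polynomial p A, ← cfc_sub _ _ A hf.continuousOn p.continuous.continuousOn]
  refine norm_cfc_le hc fun s hs => ?_
  rw [norm_sub_rev]
  -- The identity has norm at most one, with no equality needed: `H` may be trivial.
  refine h s ((spectrum.norm_le_norm_mul_of_mem hs).trans ?_)
  exact mul_le_of_le_one_right (norm_nonneg _) ContinuousLinearMap.norm_id_le

theorem eq_zero_of_opFun_eq_zero (hA : IsSelfAdjoint A) {f : ℝ → ℝ} (hf : Continuous f)
    (h : opFun A f = 0) : ∀ s ∈ spectrum ℝ A, f s = 0 := by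
  intro s hs
  have hm := cfc_map_spectrum f A hA hf.continuousOn
  have hs' : f s ∈ spectrum ℝ (opFun A f) := hm ▸ Set.mem_image_of_mem f hs
  rw [h] at hs'
  -- The spectrum of `0` is `{0}` only in a nontrivial algebra; in a trivial one it is empty,
  -- against `hs`.
  have : Nontrivial (H →L[ℂ] H) := by
    by_contra hN
    rw [not_nontrivial_iff_subsingleton] at hN
    rw [spectrum.of_subsingleton] at hs
    exact hs
  rw [spectrum.zero_eq] at hs'
  exact hs'

/-- The spectrum is the smallest closed set off which the functional calculus vanishes. -/
theorem spectrum_eq_of_opFun (hA : IsSelfAdjoint A) {S : Set ℝ} (hS : IsClosed S)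
    (hne : S.Nonempty)
    (h : ∀ f : ℝ → ℝ, Continuous f → (opFun A f = 0 ↔ ∀ s ∈ S, f s = 0)) :
    spectrum ℂ A = (fun r : ℝ => (r : ℂ)) '' S := by
  have hR : spectrum ℝ A = S := by
    apply Set.Subset.antisymm
    · intro s hs
      -- The distance to a nonempty closed set is a continuous function vanishing exactly on that
      -- set.
      have hc : Continuous fun u => Metric.infDist u S := Metric.continuous_infDist_pt S
      have h0 := eq_zero_of_opFun_eq_zero hA hc
        ((h _ hc).2 fun u hu => Metric.infDist_zero_of_mem hu) s hs
      exact (hS.mem_iff_infDist_zero hne).2 h0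
    -- `Metric.infDist` to the empty set is `0` by default, so an empty spectrum is excluded
    -- separately, by the constant function `1`.
    · rcases (spectrum ℝ A).eq_empty_or_nonempty with he | hsp
      · obtain ⟨s, hs⟩ := hne
        have h1 := (h (fun _ => 1) continuous_const).1 (by
          rw [opFun_congr (g := fun _ => 0) (by simp [he])]
          exact cfc_const_zero ℝ A) s hs
        exact absurd h1 one_ne_zero
      · intro s hs
        have hc : Continuous fun u => Metric.infDist u (spectrum ℝ A) :=
          Metric.continuous_infDist_pt _
        have h0 := (h _ hc).1 (by
          rw [opFun_congr (g := fun _ => 0) fun u hu => Metric.infDist_zero_of_mem hu]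
          exact cfc_const_zero ℝ A) s hs
        exact ((spectrum.isClosed A).mem_iff_infDist_zero hsp).2 h0
  rw [← hR, ← hA.spectrumRestricts.algebraMap_image]
  rfl

/-- A continuous approximation of the indicator function of `(-∞, r]`. -/
noncomputable def cutoff (r : ℝ) (n : ℕ) (s : ℝ) : ℝ := (1 + n * max (s - r) 0)⁻¹

theorem cutoff_denom_pos (r : ℝ) (n : ℕ) (s : ℝ) : 0 < 1 + n * max (s - r) 0 := by positivity

theorem continuous_cutoff (r : ℝ) (n : ℕ) : Continuous (cutoff r n) :=
  Continuous.inv₀ (by fun_prop) fun s => (cutoff_denom_pos r n s).ne'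

theorem abs_cutoff_le_one (r : ℝ) (n : ℕ) (s : ℝ) : |cutoff r n s| ≤ 1 := by
  rw [cutoff, abs_inv, abs_of_pos (cutoff_denom_pos r n s)]
  exact inv_le_one_of_one_le₀ (le_add_of_nonneg_right (by positivity))

theorem tendsto_cutoff (r s : ℝ) :
    Filter.Tendsto (fun n => cutoff r n s) Filter.atTop
      (nhds ((Set.Iic r).indicator (fun _ => (1 : ℝ)) s)) := by
  by_cases h : s ≤ r
  · rw [Set.indicator_of_mem (Set.mem_Iic.2 h)]
    have : ∀ n, cutoff r n s = 1 := fun n => by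
      rw [cutoff, max_eq_right (by linarith), mul_zero, add_zero, inv_one]
    simp_rw [this]
    exact tendsto_const_nhds
  · rw [Set.indicator_of_notMem (mt Set.mem_Iic.1 h)]
    refine Filter.Tendsto.inv_tendsto_atTop (Filter.tendsto_atTop_add_const_left _ _ ?_)
    refine tendsto_natCast_atTop_atTop.atTop_mul_const ?_
    exact lt_max_of_lt_left (by linarith)

/-- With `T = (A - r)⁺`, the operator `cutoff r n (A)` is the inverse of `1 + nT`. It fixes `ker T`,
and it sends `T z` to a vector of norm at most `‖z‖ / n` because `s / (1 + ns) ≤ 1/n`. As `T` is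
self-adjoint, the orthogonal complement of `ker T` is the closure of its range, and the uniform
bound `1` carries the convergence to that closure. -/
theorem tendsto_opFun_cutoff (hA : IsSelfAdjoint A) (r : ℝ) (v : H) :
    Filter.Tendsto (fun n => opFun A (cutoff r n) v) Filter.atTop
      (nhds (spectralProjection A r v)) := by
  set g : ℝ → ℝ := fun s => max (s - r) 0 with hg
  have hgc : Continuous g := by fun_prop
  set T : H →L[ℂ] H := opFun A g with hT
  have hTsa : IsSelfAdjoint T := IsSelfAdjoint.cfc
  have hbound : ∀ n, ‖opFun A (cutoff r n)‖ ≤ 1 := fun n =>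
    norm_opFun_le zero_le_one (abs_cutoff_le_one r n)
  have hker : ∀ n u, T u = 0 → opFun A (cutoff r n) u = u := by
    intro n u hu
    have h1 : opFun A (cutoff r n) * (1 + (n : ℝ) • T) = 1 := by
      have e1 : opFun A (fun s => 1 + (n : ℝ) * g s) = 1 + (n : ℝ) • T := by
        rw [opFun, cfc_add (R := ℝ) A (fun _ => 1) (fun s => (n : ℝ) * g s)
          continuousOn_const (by fun_prop), cfc_const_one ℝ A, cfc_const_mul _ _ A (by fun_prop)]
        rfl
      rw [← e1, ← opFun_mul (continuous_cutoff r n) (by fun_prop)]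
      rw [opFun_congr (f := fun s => cutoff r n s * (1 + n * g s)) (g := fun _ => 1) fun s _ =>
        inv_mul_cancel₀ (cutoff_denom_pos r n s).ne']
      exact cfc_const_one ℝ A
    have h2 := congrArg (fun S : H →L[ℂ] H => S u) h1
    simpa [hu] using h2
  have hran : ∀ n : ℕ, 0 < n → ∀ z, ‖opFun A (cutoff r n) (T z)‖ ≤ 1 / (n : ℝ) * ‖z‖ := by
    intro n hn z
    have h1 : ‖opFun A (cutoff r n) * T‖ ≤ 1 / (n : ℝ) := by
      rw [← opFun_mul (continuous_cutoff r n) hgc]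
      refine norm_opFun_le (by positivity) fun s => ?_
      have hpos : 0 ≤ g s := le_max_right _ _
      have hd := cutoff_denom_pos r n s
      have hn' : (0 : ℝ) < n := by exact_mod_cast hn
      rw [cutoff, abs_of_nonneg (by positivity), inv_mul_eq_div, div_le_div_iff₀ hd hn']
      change g s * n ≤ 1 * (1 + n * g s)
      linarith
    exact (opFun A (cutoff r n) * T).le_of_opNorm_le h1 z
  set K := LinearMap.ker T.toLinearMap with hK
  have hP : spectralProjection A r v = K.starProjection v := rfl
  set w := v - K.starProjection v with hw
  have hwK : w ∈ K.orthogonal := Submodule.sub_starProjection_mem_orthogonal v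
  have hcl : w ∈ closure (Set.range T) := by
    have h1 := ContinuousLinearMap.orthogonal_ker T
    rw [hTsa.adjoint_eq] at h1
    have h2 : w ∈ (LinearMap.range T.toLinearMap).topologicalClosure := h1 ▸ hwK
    rwa [← SetLike.mem_coe, Submodule.topologicalClosure_coe, LinearMap.coe_range] at h2
  have hPv : T (K.starProjection v) = 0 := K.starProjection_apply_mem v
  have hsplit : ∀ n, opFun A (cutoff r n) v =
      K.starProjection v + opFun A (cutoff r n) w := by
    intro n
    rw [hw, map_sub, hker n _ hPv, add_sub_cancel]
  rw [hP, Metric.tendsto_atTop]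
  intro ε hε
  obtain ⟨_, ⟨z, rfl⟩, hz⟩ := Metric.mem_closure_iff.1 hcl (ε / 2) (by positivity)
  obtain ⟨N, hN⟩ := exists_nat_gt (‖z‖ / (ε / 2))
  have hN0 : 0 < N := by
    have : (0 : ℝ) < N := lt_of_le_of_lt (by positivity) hN
    exact_mod_cast this
  refine ⟨N, fun n hn => ?_⟩
  have hn0 : 0 < n := hN0.trans_le hn
  have hn0' : (0 : ℝ) < n := by exact_mod_cast hn0
  rw [hsplit, dist_eq_norm, add_sub_cancel_left,
    show w = (w - T z) + T z by rw [sub_add_cancel], map_add]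
  rw [dist_eq_norm] at hz
  have h1 : ‖opFun A (cutoff r n) (w - T z)‖ ≤ 1 * ‖w - T z‖ :=
    (opFun A (cutoff r n)).le_of_opNorm_le (hbound n) _
  have h2 := hran n hn0 z
  have h3 : 1 / (n : ℝ) * ‖z‖ < ε / 2 := by
    rw [div_lt_iff₀ (by positivity)] at hN
    rw [one_div, inv_mul_lt_iff₀ hn0']
    refine hN.trans_le ?_
    gcongr
  calc _ ≤ _ := norm_add_le _ _
    _ < ε := by linarith

end FunctionalCalculus

/-! ### Operators on `ℓ²` through their matrix entries -/

section Matrix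

variable {V : Type*} [DecidableEq V]

/-- The expansion of `f` in point masses converges in `ℓ²`, and `S` and evaluation at `x` are
continuous. Hence the kernel of any bounded operator consists of its matrix entries. -/
theorem clm_hasSum_single (S : ℓ²(V, ℂ) →L[ℂ] ℓ²(V, ℂ)) (f : ℓ²(V, ℂ)) (x : V) :
    HasSum (fun y => S (lp.single 2 y 1) x * f y) (S f x) := by
  have h := ((lp.evalCLM ℂ (fun _ : V => ℂ) 2 x).comp S).hasSum
    (lp.hasSum_single (by norm_num) f)
  have e : ∀ y, (lp.single 2 y (f y) : ℓ²(V, ℂ)) = f y • lp.single 2 y 1 := fun y => by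
    rw [← lp.single_smul, smul_eq_mul, mul_one]
  simp_rw [e, map_smul, smul_eq_mul, mul_comm (f _)] at h
  exact h

theorem clm_ext_single {S T : ℓ²(V, ℂ) →L[ℂ] ℓ²(V, ℂ)}
    (h : ∀ x y, S (lp.single 2 y 1) x = T (lp.single 2 y 1) x) : S = T := by
  ext f x
  refine (clm_hasSum_single S f x).unique ?_
  simp_rw [h]
  exact clm_hasSum_single T f x

theorem isSelfAdjoint_of_single {S : ℓ²(V, ℂ) →L[ℂ] ℓ²(V, ℂ)}
    (h : ∀ x y, S (lp.single 2 y 1) x = starRingEnd ℂ (S (lp.single 2 x 1) y)) :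
    IsSelfAdjoint S := by
  rw [ContinuousLinearMap.isSelfAdjoint_iff']
  refine clm_ext_single fun x y => ?_
  have h1 := lp.inner_single_left (𝕜 := ℂ) x (1 : ℂ)
    (ContinuousLinearMap.adjoint S (lp.single 2 y 1))
  have h2 := lp.inner_single_right (𝕜 := ℂ) y (1 : ℂ) (S (lp.single 2 x 1))
  rw [ContinuousLinearMap.adjoint_inner_right, h2] at h1
  simp only [RCLike.inner_apply, map_one, mul_one, one_mul] at h1
  rw [← h1, h x y]

end Matrix

theorem isSelfAdjoint_negLaplacian {V : Type*} (G : SimpleGraph V) [G.LocallyFinite] {d : ℕ}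
    (h : G.IsRegularOfDegree d) : IsSelfAdjoint (negLaplacian G h) := by
  classical
  have key : ∀ x y, negLaplacian G h (lp.single 2 y 1) x =
      (if x = y then (d : ℂ) else 0) - if G.Adj x y then 1 else 0 := by
    intro x y
    have hc : (G.neighborFinset x).card = d := h x
    rw [negLaplacian_apply, Finset.sum_sub_distrib, Finset.sum_const, hc]
    simp [lp.single_apply, Pi.single_apply, G.mem_neighborFinset]
  refine isSelfAdjoint_of_single fun x y => ?_
  rw [key, key, G.adj_comm, map_sub, apply_ite (starRingEnd ℂ), apply_ite (starRingEnd ℂ)]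
  simp [eq_comm]

/-! ### Matrix entries of functions of the tree Laplacian -/

section MatrixEntries

variable {V : Type*} [DecidableEq V] {q : ℕ} {G : SimpleGraph V} [G.LocallyFinite]

/-- Orthogonality is the case `n = 0`; applying `A` in the variable `x` under the integral then
produces one more factor of the eigenvalue. -/
theorem negLaplacian_pow_single_apply (hq : 1 < q) (hG : G.IsTree)
    (hreg : G.IsRegularOfDegree (q + 1)) (n : ℕ) (x y : V) :
    ((negLaplacian G hreg) ^ n) (lp.single 2 y 1) x =
      ((∫ t, eigenvalue q t ^ n * sphericalPoly q t (G.dist x y) ∂(plancherelMeasure q) : ℝ) :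
        ℂ) := by
  induction n generalizing x with
  | zero =>
    simp only [pow_zero, one_mul]
    rw [integral_sphericalPoly hq, one_apply_eq_self, lp.single_apply,
      Pi.single_apply]
    simp [hG.connected.dist_eq_zero_iff, apply_ite Complex.ofReal]
  | succ n ih =>
    have hint : ∀ k, Integrable (fun t => eigenvalue q t ^ n * sphericalPoly q t k)
        (plancherelMeasure q) := fun k => integrable_plancherelMeasure_of_continuous hq
      (((continuous_eigenvalue q).pow n).mul (continuous_sphericalPoly q k))
    rw [pow_succ', mul_apply_eq_comp, negLaplacian_apply]
    simp_rw [ih, ← Complex.ofReal_sub, ← integral_sub (hint _) (hint _), ← Complex.ofReal_sum,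
      ← mul_sub]
    rw [← integral_finsetSum _ fun z _ => by
      simp_rw [mul_sub]; exact (hint _).sub (hint _)]
    congr 2
    ext t
    rw [← Finset.mul_sum, sum_neighbor_sphericalPoly hG hq hreg]
    ring

theorem aeval_negLaplacian_single_apply (hq : 1 < q) (hG : G.IsTree)
    (hreg : G.IsRegularOfDegree (q + 1)) (p : Polynomial ℝ) (x y : V) :
    (Polynomial.aeval (negLaplacian G hreg) p) (lp.single 2 y 1) x =
      ((∫ t, p.eval (eigenvalue q t) * sphericalPoly q t (G.dist x y) ∂(plancherelMeasure q) : ℝ) :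
        ℂ) := by
  induction p using Polynomial.induction_on' with
  | add p r hp hr =>
    have hint : ∀ p : Polynomial ℝ, Integrable
        (fun t => p.eval (eigenvalue q t) * sphericalPoly q t (G.dist x y))
        (plancherelMeasure q) := fun p => integrable_plancherelMeasure_of_continuous hq
      ((p.continuous.comp (continuous_eigenvalue q)).mul (continuous_sphericalPoly q _))
    simp_rw [Polynomial.eval_add, add_mul]
    rw [map_add, add_apply, integral_add (hint p) (hint r),
      Complex.ofReal_add, ← hp, ← hr]
    rfl
  | monomial n a =>
    simp_rw [Polynomial.eval_monomial, mul_assoc]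
    rw [Polynomial.aeval_monomial, integral_const_mul, Complex.ofReal_mul,
      ← negLaplacian_pow_single_apply hq hG hreg]
    rfl

theorem abs_eigenvalue_le (q : ℕ) (t : ℝ) : |eigenvalue q t| ≤ q + 1 + 2 * √q := by
  unfold eigenvalue
  have h := abs_le.1 (Real.abs_cos_le_one (t * Real.log q))
  rw [abs_le]
  constructor <;> nlinarith [Real.sqrt_nonneg (q : ℝ), h.1, h.2]

/-- Matrix entries of `f(A)` for continuous `f`. -/
theorem opFun_negLaplacian_single_apply (hq : 1 < q) (hG : G.IsTree)
    (hreg : G.IsRegularOfDegree (q + 1)) {f : ℝ → ℝ} (hf : Continuous f) (x y : V) :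
    (opFun (negLaplacian G hreg) f) (lp.single 2 y 1) x =
      ((∫ t, f (eigenvalue q t) * sphericalPoly q t (G.dist x y) ∂(plancherelMeasure q) : ℝ) :
        ℂ) := by
  set A := negLaplacian G hreg with hA
  have hsa : IsSelfAdjoint A := isSelfAdjoint_negLaplacian G hreg
  set k := G.dist x y with hk
  -- `[-R, R]` contains both the spectrum of `A` and all values `eigenvalue q t`, so one polynomial
  -- approximates `f` on the operator side and under the integral. The two errors, `ε/(1+C)` and
  -- `ε/(1+C) * C`, add up to `ε`.
  set R : ℝ := max ‖A‖ (q + 1 + 2 * √q) with hR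
  have hint : ∀ g : ℝ → ℝ, Continuous g → Integrable
      (fun t => g (eigenvalue q t) * sphericalPoly q t k) (plancherelMeasure q) := fun g hg =>
    integrable_plancherelMeasure_of_continuous hq
      ((hg.comp (continuous_eigenvalue q)).mul (continuous_sphericalPoly q _))
  set C : ℝ := ∫ t, |sphericalPoly q t k| ∂(plancherelMeasure q) with hC
  have hC0 : 0 ≤ C := integral_nonneg fun _ => abs_nonneg _
  rw [← sub_eq_zero, ← norm_le_zero_iff]
  refine le_of_forall_pos_le_add fun ε hε => ?_
  obtain ⟨p, hp⟩ := exists_polynomial_near_of_continuousOn (-R) R f hf.continuousOn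
    (ε / (1 + C)) (by positivity)
  have h1 : ‖opFun A f - Polynomial.aeval A p‖ ≤ ε / (1 + C) := by
    refine norm_opFun_sub_aeval_le hsa hf p (by positivity) fun s hs => (hp s ?_).le
    exact abs_le.1 (hs.trans (le_max_left _ _))
  have h2 : ‖opFun A f (lp.single 2 y 1) x - Polynomial.aeval A p (lp.single 2 y 1) x‖ ≤
      ε / (1 + C) := by
    have h3 := lp.norm_apply_le_norm (by norm_num)
      ((opFun A f - Polynomial.aeval A p) (lp.single 2 y 1)) x
    have h4 := (opFun A f - Polynomial.aeval A p).le_opNorm (lp.single 2 y 1)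
    rw [lp.norm_single (by norm_num), norm_one, mul_one] at h4
    exact h3.trans (h4.trans h1)
  have h3 : ‖(∫ t, p.eval (eigenvalue q t) * sphericalPoly q t k ∂(plancherelMeasure q)) -
      ∫ t, f (eigenvalue q t) * sphericalPoly q t k ∂(plancherelMeasure q)‖ ≤
      ε / (1 + C) * C := by
    rw [← integral_sub (hint _ p.continuous) (hint _ hf), hC, ← integral_const_mul]
    refine norm_integral_le_of_norm_le ((integrable_plancherelMeasure_of_continuous hq
      (continuous_sphericalPoly q k).abs).const_mul _) (Filter.Eventually.of_forall fun t => ?_)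
    rw [← sub_mul, norm_mul]
    refine mul_le_mul_of_nonneg_right (hp _ ?_).le (norm_nonneg _)
    exact abs_le.1 ((abs_eigenvalue_le q t).trans (le_max_right _ _))
  rw [aeval_negLaplacian_single_apply hq hG hreg] at h2
  rw [← Complex.norm_real, Complex.ofReal_sub] at h3
  calc _ ≤ _ := norm_sub_le_norm_sub_add_norm_sub _ _ _
    _ ≤ ε / (1 + C) + ε / (1 + C) * C := add_le_add h2 h3
    _ = 0 + ε := by field_simp; ring

end MatrixEntries

/-! ### The intervals of spectral parameters -/

theorem specBottom_le_eigenvalue (q : ℕ) (t : ℝ) : specBottom q ≤ eigenvalue q t := by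
  unfold specBottom eigenvalue
  nlinarith [Real.sqrt_nonneg (q : ℝ), Real.cos_le_one (t * Real.log q)]

theorem eigenvalue_le (q : ℕ) (t : ℝ) : eigenvalue q t ≤ q + 1 + 2 * √q := by
  unfold eigenvalue
  nlinarith [Real.sqrt_nonneg (q : ℝ), Real.neg_one_le_cos (t * Real.log q)]

theorem isClosed_spectralInterval (q : ℕ) (r : ℝ) : IsClosed (spectralInterval q r) :=
  isClosed_Icc.inter (isClosed_le (continuous_eigenvalue q) continuous_const)

theorem measurableSet_spectralInterval (q : ℕ) (r : ℝ) : MeasurableSet (spectralInterval q r) :=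
  (isClosed_spectralInterval q r).measurableSet

theorem spectralInterval_subset (q : ℕ) (r : ℝ) :
    spectralInterval q r ⊆ Set.Icc 0 (Real.pi / Real.log q) := Set.sep_subset _ _

theorem spectralInterval_eq_Icc {q : ℕ} (hq : 1 < q) {r : ℝ} (hr : specBottom q ≤ r) :
    spectralInterval q r =
      Set.Icc 0 (1 / Real.log q * Real.arccos ((q + 1 - r) / (2 * √q))) := by
  have hL := log_pos_of_one_lt hq
  have hs : (0 : ℝ) < 2 * √q := by positivity
  set u : ℝ := (q + 1 - r) / (2 * √q) with hu
  have hu1 : u ≤ 1 := by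
    rw [hu, div_le_one hs]
    unfold specBottom at hr
    linarith
  have hiff : ∀ t, eigenvalue q t ≤ r ↔ u ≤ Real.cos (t * Real.log q) := fun t => by
    rw [hu, div_le_iff₀ hs, eigenvalue]
    constructor <;> intro h <;> linarith
  ext t
  rw [spectralInterval, Set.mem_ofPred_eq, hiff, Set.mem_Icc, Set.mem_Icc, one_div_mul_eq_div,
    le_div_iff₀ hL, le_div_iff₀ hL]
  constructor
  · rintro ⟨⟨h0, h1⟩, h2⟩
    refine ⟨h0, ?_⟩
    rw [← Real.arccos_cos (by positivity) h1]
    exact Real.arccos_le_arccos h2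
  · rintro ⟨h0, h1⟩
    refine ⟨⟨h0, h1.trans (Real.arccos_le_pi _)⟩, ?_⟩
    -- For `u < -1` the level `r` exceeds every eigenvalue; `Real.arccos u` is then `π` and the
    -- cosine condition holds for all `t`.
    rcases le_or_gt (-1) u with h | h
    · rw [← Real.cos_arccos h hu1]
      exact Real.cos_le_cos_of_nonneg_of_le_pi (by positivity) (Real.arccos_le_pi _) h1
    · exact h.le.trans (Real.neg_one_le_cos _)

theorem exists_eigenvalue_eq {q : ℕ} (hq : 1 < q) {s : ℝ}
    (hs : s ∈ Set.Icc (specBottom q) (q + 1 + 2 * √q)) :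
    ∃ t ∈ Set.Icc 0 (Real.pi / Real.log q), eigenvalue q t = s := by
  have hL := log_pos_of_one_lt hq
  have hs' : (0 : ℝ) < 2 * √q := by positivity
  refine ⟨Real.arccos ((q + 1 - s) / (2 * √q)) / Real.log q,
    ⟨div_nonneg (Real.arccos_nonneg _) hL.le, by gcongr; exact Real.arccos_le_pi _⟩, ?_⟩
  have h1 := hs.1
  have h2 := hs.2
  unfold specBottom at h1
  rw [eigenvalue, div_mul_cancel₀ _ hL.ne', Real.cos_arccos]
  · field_simp
    ring
  · rw [le_div_iff₀ hs']; linarith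
  · rw [div_le_one hs']; linarith

/-! ### Spectrum and spectral projections of the tree Laplacian -/

/-- The density vanishes at the endpoints, so positivity gives the claim on the open interval and
continuity extends it. -/
theorem eq_zero_of_integral_sq_eq_zero {q : ℕ} (hq : 1 < q) {f : ℝ → ℝ} (hf : Continuous f)
    (h : ∫ t, f (eigenvalue q t) ^ 2 ∂(plancherelMeasure q) = 0) :
    ∀ t ∈ Set.Icc 0 (Real.pi / Real.log q), f (eigenvalue q t) = 0 := by
  have hL := log_pos_of_one_lt hq
  have hpi : 0 < Real.pi / Real.log q := div_pos Real.pi_pos hL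
  have hc := hf.comp (continuous_eigenvalue q)
  have hg : Continuous fun t => plancherelDensity q t • f (eigenvalue q t) ^ 2 :=
    (continuous_plancherelDensity hq).smul (hc.pow 2)
  rw [integral_plancherelMeasure hq, intervalIntegral.integral_of_le hpi.le,
    ← integral_Icc_eq_integral_Ioc, integral_eq_zero_iff_of_nonneg
      (fun t => smul_nonneg (plancherelDensity_nonneg hq t) (sq_nonneg _)) hg.integrableOn_Icc] at h
  have h1 := Measure.eqOn_Icc_of_ae_eq volume hpi.ne h hg.continuousOn continuousOn_const
  have h2 : Set.EqOn (fun t => f (eigenvalue q t)) (fun _ => 0)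
      (Set.Ioo 0 (Real.pi / Real.log q)) := by
    intro t ht
    have h3 := h1 (Set.Ioo_subset_Icc_self ht)
    simpa [(plancherelDensity_pos hq ht).ne'] using h3
  have h4 := h2.closure hc continuous_const
  rw [closure_Ioo hpi.ne] at h4
  exact h4

section Tree

variable {V : Type*} {q : ℕ} {G : SimpleGraph V} [G.LocallyFinite]

theorem opFun_negLaplacian_eq_zero_iff (hq : 1 < q) (hG : G.IsTree)
    (hreg : G.IsRegularOfDegree (q + 1)) {f : ℝ → ℝ} (hf : Continuous f) :
    opFun (negLaplacian G hreg) f = 0 ↔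
      ∀ s ∈ Set.Icc (specBottom q) (q + 1 + 2 * √q), f s = 0 := by
  classical
  constructor
  · intro h s hs
    obtain ⟨x⟩ := hG.connected.nonempty
    have h1 : opFun (negLaplacian G hreg) (fun s => f s ^ 2) = 0 := by
      simp_rw [pow_two]
      rw [opFun_mul hf hf, h, mul_zero]
    have h2 := opFun_negLaplacian_single_apply hq hG hreg (f := fun s => f s ^ 2) (hf.pow 2) x x
    rw [h1] at h2
    simp only [SimpleGraph.dist_self, sphericalPoly, mul_one] at h2
    have h3 : ∫ t, f (eigenvalue q t) ^ 2 ∂(plancherelMeasure q) = 0 := by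
      exact Complex.ofReal_eq_zero.1 h2.symm
    obtain ⟨t, ht, rfl⟩ := exists_eigenvalue_eq hq hs
    exact eq_zero_of_integral_sq_eq_zero hq hf h3 t ht
  · intro h
    refine clm_ext_single fun x y => ?_
    rw [opFun_negLaplacian_single_apply hq hG hreg hf]
    have : ∀ t, f (eigenvalue q t) = 0 := fun t =>
      h _ ⟨specBottom_le_eigenvalue q t, eigenvalue_le q t⟩
    simp [this]

theorem spectrum_negLaplacian (hq : 1 < q) (hG : G.IsTree)
    (hreg : G.IsRegularOfDegree (q + 1)) :
    spectrum ℂ (negLaplacian G hreg) =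
      (fun r : ℝ => (r : ℂ)) '' Set.Icc (specBottom q) (q + 1 + 2 * √q) :=
  spectrum_eq_of_opFun (isSelfAdjoint_negLaplacian G hreg) isClosed_Icc
    ⟨eigenvalue q 0, specBottom_le_eigenvalue q 0, eigenvalue_le q 0⟩
    fun _ hf => opFun_negLaplacian_eq_zero_iff hq hG hreg hf

/-- Both sides are limits of the entries of `cutoff r n (A)`: one by strong convergence, the other
by dominated convergence with majorant `|φ|`. -/
theorem spectralProjection_single_apply [DecidableEq V] (hq : 1 < q) (hG : G.IsTree)
    (hreg : G.IsRegularOfDegree (q + 1)) (r : ℝ) (x y : V) :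
    spectralProjection (negLaplacian G hreg) r (lp.single 2 y 1) x =
      ((∫ t in spectralInterval q r, sphericalPoly q t (G.dist x y) ∂(plancherelMeasure q) : ℝ) :
        ℂ) := by
  have h1 := tendsto_opFun_cutoff (isSelfAdjoint_negLaplacian G hreg) r (lp.single 2 y 1)
  have h2 := ((lp.evalCLM ℂ (fun _ : V => ℂ) 2 x).continuous.tendsto _).comp h1
  have h3 : ∀ n, lp.evalCLM ℂ (fun _ : V => ℂ) 2 x
      (opFun (negLaplacian G hreg) (cutoff r n) (lp.single 2 y 1)) = _ := fun n =>
    opFun_negLaplacian_single_apply hq hG hreg (continuous_cutoff r n) x y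
  refine tendsto_nhds_unique (h2.congr h3) ((Complex.continuous_ofReal.tendsto _).comp ?_)
  rw [← integral_indicator (measurableSet_spectralInterval q r)]
  have hc := continuous_sphericalPoly q (G.dist x y)
  refine tendsto_integral_of_dominated_convergence (fun t => |sphericalPoly q t (G.dist x y)|)
    (fun n => ?_) (integrable_plancherelMeasure_of_continuous hq hc.abs) (fun n => ?_) ?_
  · exact (((continuous_cutoff r n).comp (continuous_eigenvalue q)).mul hc).aestronglyMeasurable
  · refine Filter.Eventually.of_forall fun t => ?_
    rw [norm_mul]
    exact mul_le_of_le_one_left (norm_nonneg _) (abs_cutoff_le_one r n _)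
  · filter_upwards [ae_mem_Ioo_plancherelMeasure q] with t ht
    have h4 := (tendsto_cutoff r (eigenvalue q t)).mul_const (sphericalPoly q t (G.dist x y))
    convert h4 using 2
    by_cases h : eigenvalue q t ≤ r
    · rw [Set.indicator_of_mem (show t ∈ spectralInterval q r from
        ⟨Set.Ioo_subset_Icc_self ht, h⟩), Set.indicator_of_mem (Set.mem_Iic.2 h), one_mul]
    · rw [Set.indicator_of_notMem (fun h' : t ∈ spectralInterval q r => h h'.2),
        Set.indicator_of_notMem (mt Set.mem_Iic.1 h), zero_mul]

theorem isKernel_spectralProjection (hq : 1 < q) (hG : G.IsTree)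
    (hreg : G.IsRegularOfDegree (q + 1)) (r : ℝ) :
    IsKernel (spectralProjection (negLaplacian G hreg) r) fun x y =>
      ((∫ t in spectralInterval q r, sphericalPoly q t (G.dist x y) ∂(plancherelMeasure q) : ℝ) :
        ℂ) := by
  classical
  intro f x
  simp_rw [← spectralProjection_single_apply hq hG hreg]
  exact clm_hasSum_single _ f x

end Tree

/-- The spectral mass of the tree Laplacian, as the Plancherel measure of `I_r`. -/
noncomputable def plancherelMass (q : ℕ) (r : ℝ) : ℝ :=
  ∫ t in spectralInterval q r, plancherelDensity q t

theorem setIntegral_sphericalPoly_zero {q : ℕ} (hq : 1 < q) (r : ℝ) :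
    ∫ t in spectralInterval q r, sphericalPoly q t 0 ∂(plancherelMeasure q) =
      plancherelMass q r := by
  rw [setIntegral_plancherelMeasure hq _ (measurableSet_spectralInterval q r)
    (spectralInterval_subset q r), plancherelMass]
  simp [sphericalPoly]

theorem plancherelMass_eq_zero {q : ℕ} (hq : 1 < q) {r : ℝ} (hr : r ≤ specBottom q) :
    plancherelMass q r = 0 := by
  have hsub : spectralInterval q r ⊆ {0} := by
    have h1 : spectralInterval q r ⊆ spectralInterval q (specBottom q) :=
      fun t ht => ⟨ht.1, ht.2.trans hr⟩
    have hs : (2 * √q : ℝ) ≠ 0 := by positivity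
    rw [spectralInterval_eq_Icc hq le_rfl, specBottom,
      show ((q : ℝ) + 1 - (q + 1 - 2 * √q)) / (2 * √q) = 1 by rw [sub_sub_cancel, div_self hs],
      Real.arccos_one, mul_zero, Set.Icc_self] at h1
    exact h1
  exact setIntegral_measure_zero _ (measure_mono_null hsub Real.volume_singleton)

/-! ### Asymptotics at the bottom of the spectrum -/

/-- The Plancherel density in the variable `θ = t log q`. -/
noncomputable def angularDensity (q : ℕ) (θ : ℝ) : ℝ :=
  4 * q * (q + 1) / (2 * Real.pi) * (Real.sin θ ^ 2 / (((q : ℝ) - 1) ^ 2 + 4 * q * Real.sin θ ^ 2))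

theorem plancherelMass_eq_integral {q : ℕ} (hq : 1 < q) {r : ℝ} (hr : specBottom q ≤ r) :
    plancherelMass q r =
      ∫ θ in (0 : ℝ)..Real.arccos ((q + 1 - r) / (2 * √q)), angularDensity q θ := by
  have hL := log_pos_of_one_lt hq
  have hpt : ∀ t, plancherelDensity q t = Real.log q * angularDensity q (t * Real.log q) := by
    intro t
    have hD := (denominator_pos hq (t * Real.log q)).ne'
    have hpi := Real.pi_ne_zero
    rw [plancherelDensity, angularDensity]
    field_simp
  rw [plancherelMass, spectralInterval_eq_Icc hq hr, integral_Icc_eq_integral_Ioc,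
    ← intervalIntegral.integral_of_le (mul_nonneg (by positivity) (Real.arccos_nonneg _))]
  simp_rw [hpt]
  rw [intervalIntegral.integral_const_mul, intervalIntegral.integral_comp_mul_right _ hL.ne',
    zero_mul, smul_eq_mul, mul_inv_cancel_left₀ hL.ne', one_div_mul_eq_div,
    div_mul_cancel₀ _ hL.ne']

theorem abs_sin_sq_sub_sq_le {θ : ℝ} (hθ : 0 ≤ θ) : |Real.sin θ ^ 2 - θ ^ 2| ≤ θ ^ 4 := by
  rcases hθ.eq_or_lt with rfl | h
  · simp
  have h1 := Real.sin_gt_sub_cube h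
  have h2 := Real.sin_lt h
  have h3 := (abs_le.1 (Real.abs_sin_le_abs (x := θ))).1
  rw [abs_of_nonneg hθ] at h3
  rw [show Real.sin θ ^ 2 - θ ^ 2 = -((θ - Real.sin θ) * (θ + Real.sin θ)) by ring, abs_neg,
    abs_of_nonneg (mul_nonneg (by linarith) (by linarith))]
  calc _ ≤ (θ ^ 3 / 6) * (2 * θ) := by
        refine mul_le_mul (by linarith) (by linarith) (by linarith) (by positivity)
    _ ≤ θ ^ 4 := by nlinarith [pow_pos h 4]

theorem abs_angularDensity_sub_le {q : ℕ} (hq : 1 < q) :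
    ∃ C, 0 ≤ C ∧ ∀ θ, 0 ≤ θ →
      |angularDensity q θ - 4 * q * (q + 1) / (2 * Real.pi) / ((q : ℝ) - 1) ^ 2 * θ ^ 2| ≤
        C * θ ^ 4 := by
  have hq' : 0 < (q : ℝ) - 1 := sub_pos.2 (by exact_mod_cast hq)
  set a : ℝ := ((q : ℝ) - 1) ^ 2 with ha
  have ha0 : 0 < a := by positivity
  set c : ℝ := 4 * q * (q + 1) / (2 * Real.pi) with hc
  have hc0 : 0 ≤ c := by positivity
  clear_value c a
  -- Over a common denominator the numerator is `a (sin² θ - θ²) - 4q sin² θ θ²`, at most `(a + 4q)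
  -- θ⁴` in absolute value, and the denominator is at least `a²`.
  refine ⟨c * ((a + 4 * q) / a ^ 2), by positivity, fun θ hθ => ?_⟩
  have hD := denominator_pos hq θ
  have h1 := abs_sin_sq_sub_sq_le hθ
  have h2 : Real.sin θ ^ 2 ≤ θ ^ 2 := Real.sin_sq_le_sq
  rw [angularDensity, ← hc, ← ha]
  rw [← ha] at hD
  have e : c * (Real.sin θ ^ 2 / (a + 4 * q * Real.sin θ ^ 2)) - c / a * θ ^ 2 =
      c * ((a * (Real.sin θ ^ 2 - θ ^ 2) - 4 * q * (Real.sin θ ^ 2 * θ ^ 2)) /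
        (a * (a + 4 * q * Real.sin θ ^ 2))) := by
    field_simp
    ring
  rw [e, abs_mul, abs_of_nonneg hc0, mul_assoc c _ (θ ^ 4), div_mul_eq_mul_div, abs_div,
    abs_of_pos (mul_pos ha0 hD)]
  refine mul_le_mul_of_nonneg_left (div_le_div₀ (by positivity) ?_ (by positivity) ?_) hc0
  · refine (abs_sub _ _).trans ?_
    rw [abs_mul, abs_of_pos ha0, abs_of_nonneg (a := 4 * (q : ℝ) * _) (by positivity), add_mul]
    have h3 : Real.sin θ ^ 2 * θ ^ 2 ≤ θ ^ 4 := by nlinarith [sq_nonneg θ]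
    gcongr
  · rw [pow_two]
    exact mul_le_mul_of_nonneg_left (le_add_of_nonneg_right (by positivity)) ha0.le

theorem abs_integral_angularDensity_sub_le {q : ℕ} (hq : 1 < q) :
    ∃ C, 0 ≤ C ∧ ∀ θ, 0 ≤ θ →
      |(∫ s in (0 : ℝ)..θ, angularDensity q s) -
        4 * q * (q + 1) / (2 * Real.pi) / ((q : ℝ) - 1) ^ 2 * (θ ^ 3 / 3)| ≤ C * θ ^ 5 := by
  obtain ⟨C, hC, h⟩ := abs_angularDensity_sub_le hq
  refine ⟨C / 5, by positivity, fun θ hθ => ?_⟩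
  have hcont : Continuous (angularDensity q) :=
    continuous_const.mul (Continuous.div (by fun_prop) (by fun_prop)
      fun s => (denominator_pos hq s).ne')
  set b : ℝ := 4 * q * (q + 1) / (2 * Real.pi) / ((q : ℝ) - 1) ^ 2
  have e1 : b * (θ ^ 3 / 3) = ∫ s in (0 : ℝ)..θ, b * s ^ 2 := by
    rw [intervalIntegral.integral_const_mul, integral_pow]; norm_num
  have e2 : C / 5 * θ ^ 5 = ∫ s in (0 : ℝ)..θ, C * s ^ 4 := by
    rw [intervalIntegral.integral_const_mul, integral_pow]; norm_num; ring
  rw [e1, e2, ← intervalIntegral.integral_sub (hcont.intervalIntegrable _ _)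
    (Continuous.intervalIntegrable (by fun_prop) _ _)]
  exact intervalIntegral.norm_integral_le_of_norm_le (f := fun s => angularDensity q s - b * s ^ 2)
    (g := fun s => C * s ^ 4) hθ
    (Filter.Eventually.of_forall fun s hs => h s hs.1.le)
    (Continuous.intervalIntegrable (by fun_prop) _ _)

/-- The sine of the half angle is the quantity that `ε` determines exactly, so powers of the angle
are traded for powers of it. The `24` is `2 * 12`, from factoring the difference of cubes (`h5`,
`h6`). -/
theorem half_angle_estimates {φ : ℝ} (h0 : 0 < φ) (h1 : φ ≤ Real.pi / 2) :
    0 < Real.sin φ ∧ φ ≤ 2 * Real.sin φ ∧ |φ ^ 3 - Real.sin φ ^ 3| ≤ 24 * Real.sin φ ^ 5 := by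
  have hs : 0 < Real.sin φ := Real.sin_pos_of_pos_of_lt_pi h0 (by linarith [Real.pi_pos])
  have hlt := Real.sin_lt h0
  have h2 : φ ≤ 2 * Real.sin φ := by
    have h3 := Real.mul_le_sin h0.le h1
    have hpi := Real.pi_pos
    have hpi4 := Real.pi_le_four
    rw [div_mul_eq_mul_div, div_le_iff₀ hpi] at h3
    nlinarith
  refine ⟨hs, h2, ?_⟩
  have h3 := Real.sin_gt_sub_cube h0
  set v := Real.sin φ
  have h4 : φ ^ 3 ≤ 8 * v ^ 3 := by
    calc φ ^ 3 ≤ (2 * v) ^ 3 := by gcongr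
      _ = _ := by ring
  have h5 : φ - v ≤ 2 * v ^ 3 := by nlinarith [pow_pos hs 3]
  have h6 : φ ^ 2 + φ * v + v ^ 2 ≤ 12 * v ^ 2 := by nlinarith
  rw [show φ ^ 3 - v ^ 3 = (φ - v) * (φ ^ 2 + φ * v + v ^ 2) by ring,
    abs_of_nonneg (mul_nonneg (by linarith) (by positivity))]
  calc _ ≤ 2 * v ^ 3 * (12 * v ^ 2) := mul_le_mul h5 h6 (by positivity) (by positivity)
    _ = _ := by ring

/-- From `1 - cos θ = 2 sin² (θ/2)` one gets `ε = (2κv)²` with `v = sin (θ/2)` and `κ = q^(1/4)`.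
Half-integral powers of `ε` become integral powers of `v`, and the main term is exactly `b *
(8v³/3)`. -/
theorem plancherelMass_asymptotics {q : ℕ} (hq : 1 < q) :
    (fun ε : ℝ => plancherelMass q (specBottom q + ε) -
          2 * (q : ℝ) ^ (1 / 4 : ℝ) * (q + 1) / (3 * Real.pi * ((q : ℝ) - 1) ^ 2) *
            ε ^ (3 / 2 : ℝ))
        =O[nhdsWithin 0 (Set.Ioi 0)] (fun ε : ℝ => ε ^ (5 / 2 : ℝ)) := by
  have hq' : 0 < (q : ℝ) - 1 := sub_pos.2 (by exact_mod_cast hq)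
  have hq0 : (0 : ℝ) < q := by linarith
  obtain ⟨C, hC, hW⟩ := abs_integral_angularDensity_sub_le hq
  set κ : ℝ := (q : ℝ) ^ (1 / 4 : ℝ) with hκ
  have hκ0 : 0 < κ := Real.rpow_pos_of_pos hq0 _
  have hκ2 : κ ^ 2 = √q := by
    rw [hκ, ← Real.rpow_natCast, ← Real.rpow_mul hq0.le, Real.sqrt_eq_rpow]; norm_num
  have hκ4 : κ ^ 4 = q := by
    rw [show κ ^ 4 = (κ ^ 2) ^ 2 by ring, hκ2, Real.sq_sqrt hq0.le]
  set b : ℝ := 4 * q * (q + 1) / (2 * Real.pi) / ((q : ℝ) - 1) ^ 2 with hb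
  have hb0 : 0 ≤ b := by positivity
  -- The first summand comes from the density error with `θ ≤ 4v`, the second from replacing `θ³` by
  -- `8v³`; the divisor converts `v⁵` into `ε^(5/2)`.
  refine Asymptotics.IsBigO.of_bound ((C * 4 ^ 5 + b * (8 * 24 / 3)) / (2 * κ) ^ 5) ?_
  -- The bound `ε < 4√q` keeps the argument of `arccos` above `-1`.
  filter_upwards [Ioo_mem_nhdsGT (show (0 : ℝ) < 4 * √q by positivity)] with ε hε
  have hs0 : (0 : ℝ) < √q := by positivity
  rw [plancherelMass_eq_integral hq (by linarith [hε.1]), specBottom,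
    show ((q : ℝ) + 1 - (q + 1 - 2 * √q + ε)) / (2 * √q) = 1 - ε / (2 * √q) by field_simp; ring]
  set θ := Real.arccos (1 - ε / (2 * √q)) with hθ
  have hu0 : 0 < ε / (2 * √q) := div_pos hε.1 (by positivity)
  have hu2 : ε / (2 * √q) < 2 := by
    rw [div_lt_iff₀ (by positivity)]; linarith [hε.2]
  have hcos : Real.cos θ = 1 - ε / (2 * √q) := Real.cos_arccos (by linarith) (by linarith)
  have hθ0 : 0 < θ := Real.arccos_pos.2 (by linarith)
  have hθpi : θ ≤ Real.pi := Real.arccos_le_pi _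
  obtain ⟨hv, hv1, hv3⟩ := half_angle_estimates (φ := θ / 2) (by linarith) (by linarith)
  set v := Real.sin (θ / 2) with hvdef
  have hε' : ε = (2 * κ * v) ^ 2 := by
    have h1 : Real.cos θ = 1 - 2 * v ^ 2 := by
      rw [show θ = 2 * (θ / 2) by ring, Real.cos_two_mul, Real.cos_sq', ← hvdef]; ring
    rw [h1] at hcos
    have h2 : ε / (2 * √q) = 2 * v ^ 2 := by linarith
    rw [div_eq_iff (by positivity)] at h2
    rw [h2, mul_pow, mul_pow, hκ2]; ring
  have hpow : ∀ k : ℕ, ε ^ (k / 2 : ℝ) = (2 * κ * v) ^ k := fun k => by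
    rw [hε', ← Real.rpow_natCast, ← Real.rpow_mul (by positivity), ← Real.rpow_natCast]
    congr 1
    push_cast
    ring
  have e3 := hpow 3
  have e5 := hpow 5
  push_cast at e3 e5
  rw [e3, e5]
  have hmain : 2 * κ * (q + 1) / (3 * Real.pi * ((q : ℝ) - 1) ^ 2) * (2 * κ * v) ^ 3 =
      b * (8 * v ^ 3 / 3) := by
    rw [hb, ← hκ4]
    have hpi := Real.pi_ne_zero
    rw [hκ4]
    have : 2 * κ * (q + 1) / (3 * Real.pi * ((q : ℝ) - 1) ^ 2) * (2 * κ * v) ^ 3 =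
      16 * κ ^ 4 * (q + 1) * v ^ 3 / (3 * Real.pi * ((q : ℝ) - 1) ^ 2) := by ring
    rw [this, hκ4]
    field_simp
    ring
  rw [hmain, Real.norm_eq_abs, Real.norm_of_nonneg (by positivity)]
  have hA := hW θ hθ0.le
  have hB : |b * (θ ^ 3 / 3) - b * (8 * v ^ 3 / 3)| ≤ b * (8 * 24 / 3) * v ^ 5 := by
    rw [show b * (θ ^ 3 / 3) - b * (8 * v ^ 3 / 3) = b * (8 / 3) * ((θ / 2) ^ 3 - v ^ 3) by ring,
      abs_mul, abs_of_nonneg (by positivity)]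
    calc _ ≤ b * (8 / 3) * (24 * v ^ 5) := by gcongr
      _ = _ := by ring
  have hθ5 : θ ^ 5 ≤ 4 ^ 5 * v ^ 5 := by
    rw [← mul_pow]
    exact pow_le_pow_left₀ hθ0.le (by linarith) 5
  calc _ ≤ _ := abs_sub_le _ (b * (θ ^ 3 / 3)) _
    _ ≤ C * (4 ^ 5 * v ^ 5) + b * (8 * 24 / 3) * v ^ 5 :=
      add_le_add (hA.trans (by gcongr)) hB
    _ = _ := by field_simp

end TreeSpectralMass

theorem mainTheorem4 {V : Type*} (q : ℕ) (hq : 1 < q) (G : SimpleGraph V) [G.LocallyFinite]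
    (hG : G.IsTree) (hreg : G.IsRegularOfDegree (q + 1)) :
    -- the operator is self-adjoint and its spectrum is an interval with bottom `q + 1 - 2√q`
    IsSelfAdjoint (TreeSpectralMass.negLaplacian G hreg) ∧
    spectrum ℂ (TreeSpectralMass.negLaplacian G hreg) =
      (fun r : ℝ => (r : ℂ)) '' Set.Icc (TreeSpectralMass.specBottom q) (q + 1 + 2 * √q) ∧
    -- the Plancherel density in terms of the `c`-function
    (∀ t ∈ Set.Ioo 0 (Real.pi / Real.log q),
      TreeSpectralMass.plancherelDensity q t =
        q * Real.log q / (2 * Real.pi * (q + 1)) *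
          (‖TreeSpectralMass.cFun q (1 / 2 + Complex.I * t)‖ ^ 2)⁻¹) ∧
    -- the set of spectral parameters with eigenvalue at most `r` is an explicit interval
    (∀ r, TreeSpectralMass.specBottom q ≤ r →
      TreeSpectralMass.spectralInterval q r =
        Set.Icc 0 (1 / Real.log q * Real.arccos ((q + 1 - r) / (2 * √q)))) ∧
    (∀ n : ℕ, MeasureTheory.Integrable
      (fun t : ℝ => TreeSpectralMass.sphericalFun q (1 / 2 + Complex.I * t) n)
      (TreeSpectralMass.plancherelMeasure q)) ∧
    ∃ (K : ℝ → V → V → ℂ) (M : ℝ → ℝ),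
      TreeSpectralMass.IsSpectralMass (TreeSpectralMass.negLaplacian G hreg) K M ∧
      -- the kernel of the spectral projection
      (∀ r x y, K r x y = ∫ t in TreeSpectralMass.spectralInterval q r,
        TreeSpectralMass.sphericalFun q (1 / 2 + Complex.I * t) (G.dist x y)
          ∂(TreeSpectralMass.plancherelMeasure q)) ∧
      -- the spectral mass is the Plancherel measure of the interval of spectral parameters
      (∀ r, TreeSpectralMass.plancherelMeasure q (TreeSpectralMass.spectralInterval q r) =
        ENNReal.ofReal (M r)) ∧
      (∀ r, M r = ∫ t in TreeSpectralMass.spectralInterval q r,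
        TreeSpectralMass.plancherelDensity q t) ∧
      (∀ r, r ≤ TreeSpectralMass.specBottom q → M r = 0) ∧
      (fun ε : ℝ => M (TreeSpectralMass.specBottom q + ε) -
          2 * (q : ℝ) ^ (1 / 4 : ℝ) * (q + 1) / (3 * Real.pi * ((q : ℝ) - 1) ^ 2) *
            ε ^ (3 / 2 : ℝ))
        =O[nhdsWithin 0 (Set.Ioi 0)] (fun ε : ℝ => ε ^ (5 / 2 : ℝ)) := by
  refine ⟨TreeSpectralMass.isSelfAdjoint_negLaplacian G hreg,
    TreeSpectralMass.spectrum_negLaplacian hq hG hreg, fun t ht => ?_,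
    fun r hr => TreeSpectralMass.spectralInterval_eq_Icc hq hr, fun n => ?_,
    -- The witness uses `sphericalPoly`, which is real and continuous up to the endpoints; it agrees
    -- with `sphericalFun` almost everywhere, hence under the integral.
    fun r x y => ((∫ t in TreeSpectralMass.spectralInterval q r,
      TreeSpectralMass.sphericalPoly q t (G.dist x y)
        ∂(TreeSpectralMass.plancherelMeasure q) : ℝ) : ℂ),
    TreeSpectralMass.plancherelMass q,
    ⟨fun r => TreeSpectralMass.isKernel_spectralProjection hq hG hreg r, fun r x => ?_⟩,
    fun r x y => ?_,
    fun r => TreeSpectralMass.plancherelMeasure_apply hq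
      (TreeSpectralMass.measurableSet_spectralInterval q r)
      (TreeSpectralMass.spectralInterval_subset q r),
    fun r => rfl, fun r hr => TreeSpectralMass.plancherelMass_eq_zero hq hr,
    TreeSpectralMass.plancherelMass_asymptotics hq⟩
  · have h := TreeSpectralMass.mul_log_mem_Ioo hq ht
    exact TreeSpectralMass.plancherelDensity_eq_cFun hq
      (Real.sin_pos_of_pos_of_lt_pi h.1 h.2).ne'
  · exact (TreeSpectralMass.integrable_plancherelMeasure_of_continuous hq
      (Complex.continuous_ofReal.comp (TreeSpectralMass.continuous_sphericalPoly q n))).congr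
      (TreeSpectralMass.ae_sphericalFun_eq hq n).symm
  · simp only [SimpleGraph.dist_self]
    rw [TreeSpectralMass.setIntegral_sphericalPoly_zero hq]
  · refine integral_complex_ofReal.symm.trans ?_
    exact MeasureTheory.integral_congr_ae
      (MeasureTheory.ae_restrict_of_ae (TreeSpectralMass.ae_sphericalFun_eq hq _).symm)
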